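/- **Setting.** Let $\mathcal X\subseteq\mathbb R^n$, $\mathcal U\subseteq\mathbb R^m$, $\mathcal W\subseteq\mathbb R^l$ be Borel sets, $f:\mathcal X\times\mathcal U\times\mathcal W\to\mathcal X$ Borel measurable, $\mathcal U(x)\subseteq\mathcal U$ the admissible controls at $x$, $\mathbb K=\{(x,u): u\in\mathcal U(x)\}$, $c:\mathcal X\times\mathcal U\to\mathbb R$ a stage cost and $\alpha\in(0,1)$. Let $d$ be a (Borel measurable) metric on $\mathcal W$, $p\in[1,\infty)$, $\theta>0$, $N\ge 1$, $\hat w^{(1)},\dots,\hat w^{(N)}\in\mathcal W$, $\nu_N=\frac1N\sum_{i=1}^N\delta_{\hat w^{(i)}}$, and let $\mathcal D=\{\mu\in\mathcal P(\mathcal W): W_p(\mu,\nu_N)\le\theta\}$ be the ball for the Wasserstein distance $W_p$ of order $p$ with respect to $d$. Assume: 1. $c$ is lower semicontinuous on $\mathbb K$ and $|c(x,u)|\le b\,\xi(x)$ on $\mathbb K$ for a constant $b\ge0$ and a continuous $\xi:\mathcal X\to[1,\infty)$; for every $\mu\in\mathcal D$ the function $\xi'_\mu(x,u)=\int\xi(f(x,u,w))\,\mu(dw)$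 is finite and continuous on $\mathbb K$; and there is a constant $\beta\in[1,1/\alpha)$ with $\xi'_\mu(x,u)\le\beta\,\xi(x)$ for all $(x,u)\in\mathbb K$ and $\mu\in\mathcal D$. 2. For every bounded continuous $\chi:\mathcal X\to\mathbb R$ and every $\mu\in\mathcal D$, $(x,u)\mapsto\int\chi(f(x,u,w))\,\mu(dw)$ is continuous on $\mathbb K$. 3. Every $\mathcal U(x)$ is compact, and $x\mapsto\mathcal U(x)$ is upper semicontinuous. Fix a deterministic stationary policy $\pi$ of Player I, i.e. a Borel measurable $\pi:\mathcal X\to\mathcal U$ with $\pi(x)\in\mathcal U(x)$ for all $x$. A strategy of Player II is a sequence $\gamma=(\gamma_t)_{t\ge0}$ of universally measurable stochastic kernels, where $\gamma_t$ maps extended histories $(x_0,u_0,\mu_0,\dots,x_{t-1},u_{t-1},\mu_{t-1},x_t,u_t)$ to probability measures on $\mathcal P(\mathcal W)$ concentrated on $\mathcal D$; $\Gamma$ is the set of these strategies. In the game $u_t=\pi(x_t)$, $\mu_t$ is drawn from $\gamma_t$, and $x_{t+1}=f(x_t,u_t,w_t)$ with $w_t\sim\mu_t$. Put $J_x(\pi,\gamma)=\mathbb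 E^{\pi,\gamma}\big[\sum_{t\ge0}\alpha^t c(x_t,u_t)\mid x_0=x\big]$ and $v^\pi(x)=\sup_{\gamma\in\Gamma}J_x(\pi,\gamma)$. A strategy $\gamma\in\Gamma$ is optimal if $J_x(\pi,\gamma)=v^\pi(x)$ for all $x\in\mathcal X$. A universally measurable $g:\mathcal X\to\mathcal D$ is identified with the deterministic stationary strategy that plays $\mu_t=g(x_t)$. For $x\in\mathcal X$ consider the finite-dimensional problem, over lower atoms $\underline w\in\mathcal W^N$, upper atoms $\overline w\in\mathcal W^N$ and weights $q=(q_1,q_2)$ with $q_1,q_2\ge0$, $q_1+q_2=1$, $$\max\ c(x,\pi(x))+\frac{\alpha}{N}\sum_{i=1}^N\Big[q_1v^\pi\big(f(x,\pi(x),\underline w^{(i)})\big)+q_2v^\pi\big(f(x,\pi(x),\overline w^{(i)})\big)\Big]$$ $$\text{s.t. }\ \frac1N\sum_{i=1}^N\Big[q_1d(\underline w^{(i)},\hat w^{(i)})^p+q_2d(\overline w^{(i)},\hat w^{(i)})^p\Big]\le\theta^p .\qquad (\ast)$$ **Proposition (worst-case distribution policy).** Assume that for every $x\in\mathcal X$ the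 supremum $$\sup_{\mu\in\mathcal D}\Big[c(x,\pi(x))+\alpha\int_{\mathcal W}v^\pi(f(x,\pi(x),w))\,\mu(dw)\Big]$$ is attained. Then: (i) There is a universally measurable choice $x\mapsto(\underline w_x,\overline w_x,q_x)$ of optimal solutions of $(\ast)$ such that $$\gamma^\pi(x)=\frac1N\sum_{i=1}^N\Big(q_{x,1}\,\delta_{\underline w_x^{(i)}}+q_{x,2}\,\delta_{\overline w_x^{(i)}}\Big)$$ is an optimal deterministic stationary strategy of Player II. (ii) For every choice $x\mapsto(\underline w_x,\overline w_x,q_x)$ of optimal solutions of $(\ast)$, the distribution $\gamma^\pi(x)$ lies in $\mathcal D$ and attains the supremum above for every $x$; and if $\gamma^\pi$ is universally measurable (in particular, if it is Borel measurable), then it is an optimal strategy of Player II. -/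

import Mathlib

open MeasureTheory Set
open scoped ENNReal

noncomputable section

/-- `g` is universally measurable: preimages of measurable sets belong to the completion of the
σ-algebra of the domain with respect to every probability measure. Every measurable map is
universally measurable. -/
def UniversallyMeasurable {α β : Type*} [MeasurableSpace α] [MeasurableSpace β] (g : α → β) :
    Prop :=
  ∀ P : Measure α, IsProbabilityMeasure P → NullMeasurable g P

/-- The data of a distributionally robust control problem with `x' = f (x, u, w)`: Borel sets of
states, controls and disturbances, admissible controls, stage cost, discount factor, a (Borel)
metric `d` on the disturbance set, the order `p` and the radius `θ` of the Wasserstein ball, and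
the sample of size `N`. -/
structure DRSystem (n m l N : ℕ) where
  X : Set (EuclideanSpace ℝ (Fin n))
  U : Set (EuclideanSpace ℝ (Fin m))
  W : Set (EuclideanSpace ℝ (Fin l))
  measurableSet_X : MeasurableSet X
  measurableSet_U : MeasurableSet U
  measurableSet_W : MeasurableSet W
  f : X → U → W → X
  measurable_f : Measurable fun z : X × U × W => f z.1 z.2.1 z.2.2
  adm : X → Set U
  c : X → U → ℝ
  α : ℝ
  α_pos : 0 < α
  α_lt_one : α < 1
  d : W → W → ℝ
  d_eq_zero : ∀ w w', d w w' = 0 ↔ w = w'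
  d_symm : ∀ w w', d w w' = d w' w
  d_triangle : ∀ w w' w'', d w w'' ≤ d w w' + d w' w''
  measurable_d : Measurable fun z : W × W => d z.1 z.2
  p : ℝ
  one_le_p : 1 ≤ p
  θ : ℝ
  θ_pos : 0 < θ
  sample : Fin N → W
  N_pos : 0 < N

namespace DRSystem

variable {n m l N : ℕ} (S : DRSystem n m l N)

/-! ### The Wasserstein ambiguity set -/

/-- The empirical distribution of the sample. -/
def empirical : Measure S.W :=
  (N : ℝ≥0∞)⁻¹ • ∑ i, Measure.dirac (S.sample i)

/-- The Wasserstein distance of order `p` for the metric `d`. -/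
def wasserstein (μ ν : Measure S.W) : ℝ≥0∞ :=
  ⨅ κ ∈ {κ : Measure (S.W × S.W) | κ.map Prod.fst = μ ∧ κ.map Prod.snd = ν},
    (∫⁻ z, ENNReal.ofReal (S.d z.1 z.2 ^ S.p) ∂κ) ^ (1 / S.p)

/-- The ambiguity set: the Wasserstein ball of radius `θ` around the empirical distribution. -/
def ball : Set (ProbabilityMeasure S.W) :=
  {μ | S.wasserstein (μ : Measure S.W) S.empirical ≤ ENNReal.ofReal S.θ}

/-! ### The semicontinuity assumption -/

/-- The admissible state-control pairs. -/
def K : Set (S.X × S.U) := {z | z.2 ∈ S.adm z.1}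

/-- The semicontinuous model with weight function `ξ` and constants `b`, `β`. -/
structure SemicontinuousModel (ξ : S.X → ℝ) (b β : ℝ) : Prop where
  lsc_cost : LowerSemicontinuousOn (fun z : S.X × S.U => S.c z.1 z.2) S.K
  b_nonneg : 0 ≤ b
  abs_cost_le : ∀ z ∈ S.K, |S.c z.1 z.2| ≤ b * ξ z.1
  continuous_weight : Continuous ξ
  one_le_weight : ∀ x, 1 ≤ ξ x
  one_le_β : 1 ≤ β
  β_lt : β < 1 / S.α
  integrable_weight : ∀ μ ∈ S.ball, ∀ z ∈ S.K,
    Integrable (fun w => ξ (S.f z.1 z.2 w)) (μ : Measure S.W)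
  continuousOn_weight : ∀ μ ∈ S.ball,
    ContinuousOn (fun z : S.X × S.U => ∫ w, ξ (S.f z.1 z.2 w) ∂(μ : Measure S.W)) S.K
  weight_le : ∀ μ ∈ S.ball, ∀ z ∈ S.K,
    ∫ w, ξ (S.f z.1 z.2 w) ∂(μ : Measure S.W) ≤ β * ξ z.1
  continuousOn_integral : ∀ χ : S.X → ℝ, Continuous χ → (∃ C, ∀ x, |χ x| ≤ C) → ∀ μ ∈ S.ball,
    ContinuousOn (fun z : S.X × S.U => ∫ w, χ (S.f z.1 z.2 w) ∂(μ : Measure S.W)) S.K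
  isCompact_adm : ∀ x, IsCompact (S.adm x)
  usc_adm : UpperHemicontinuous S.adm

/-! ### Policies, the induced law, and the cost -/

/-- One stage `(x_t, u_t, μ_t)` of the game. -/
abbrev Stage : Type := S.X × S.U × ProbabilityMeasure S.W

/-- Extended histories `(x_0, u_0, μ_0, …, x_{t-1}, u_{t-1}, μ_{t-1}, x_t, u_t)`. -/
abbrev HistE (t : ℕ) : Type := (Fin t → S.Stage) × S.X × S.U

/-- Trajectories of the game. -/
abbrev Traj : Type := ℕ → S.Stage

/-- The stages before time `t` of a trajectory. -/
def past (t : ℕ) (ω : S.Traj) : Fin t → S.Stage := fun s => ω s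

/-- The extended history at time `t` of a trajectory. -/
def histE (t : ℕ) (ω : S.Traj) : S.HistE t := (S.past t ω, (ω t).1, (ω t).2.1)

/-- Deterministic stationary policies of Player I. -/
def IsDetStationary (π : S.X → S.U) : Prop := Measurable π ∧ ∀ x, π x ∈ S.adm x

/-- A (raw) strategy of Player II: at each time, a measure on the set of disturbance
distributions that depends on the extended history. -/
abbrev Adversary : Type := ∀ t : ℕ, S.HistE t → Measure (ProbabilityMeasure S.W)

/-- The admissible strategies of Player II: universally measurable stochastic kernels that are
concentrated on the ambiguity set. -/
def IsAdversary (γ : S.Adversary) : Prop :=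
  ∀ t, UniversallyMeasurable (γ t) ∧
    ∀ h, IsProbabilityMeasure (γ t h) ∧ ∀ᵐ μ ∂(γ t h), μ ∈ S.ball

/-- The deterministic stationary strategy of Player II given by a map from states to
distributions. -/
def stationary (g : S.X → ProbabilityMeasure S.W) : S.Adversary :=
  fun _ h => Measure.dirac (g h.2.1)

/-- `P` is the law of the trajectory started at `x`, when Player I uses the deterministic
stationary policy `π` and Player II uses `γ`: given the extended history up to time `t`, the
distribution `μ_t` is drawn from `γ t`, and given everything up to and including stage `t`,
the next state is distributed as `f (x_t, u_t, w)` with `w ∼ μ_t`. -/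
structure IsInducedLaw (π : S.X → S.U) (γ : S.Adversary) (x : S.X) (P : Measure S.Traj) :
    Prop where
  isProbabilityMeasure : IsProbabilityMeasure P
  initial : ∀ᵐ ω ∂P, (ω 0).1 = x
  control : ∀ t, ∀ᵐ ω ∂P, (ω t).2.1 = π (ω t).1
  adversary : ∀ t, ∀ A : Set (S.HistE t), MeasurableSet A →
    ∀ B : Set (ProbabilityMeasure S.W), MeasurableSet B →
      P {ω | S.histE t ω ∈ A ∧ (ω t).2.2 ∈ B} =
        ∫⁻ ω in {ω | S.histE t ω ∈ A}, γ t (S.histE t ω) B ∂P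
  transition : ∀ t, ∀ A : Set (Fin (t + 1) → S.Stage), MeasurableSet A →
    ∀ B : Set S.X, MeasurableSet B →
      P {ω | S.past (t + 1) ω ∈ A ∧ (ω (t + 1)).1 ∈ B} =
        ∫⁻ ω in {ω | S.past (t + 1) ω ∈ A},
          ((ω t).2.2 : Measure S.W) {w | S.f (ω t).1 (ω t).2.1 w ∈ B} ∂P

open Classical in
/-- The law of the trajectory. The conditions in `IsInducedLaw` determine it uniquely, and for
admissible strategies it exists (Ionescu-Tulcea). -/
def law (π : S.X → S.U) (γ : S.Adversary) (x : S.X) : Measure S.Traj :=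
  if h : ∃ P, S.IsInducedLaw π γ x P then h.choose else 0

/-- The expected discounted cost `J_x (π, γ)`. -/
def J (π : S.X → S.U) (γ : S.Adversary) (x : S.X) : ℝ :=
  ∫ ω, ∑' t : ℕ, S.α ^ t * S.c (ω t).1 (ω t).2.1 ∂(S.law π γ x)

/-- The worst-case value function `v^π (x)`, the supremum of `J_x (π, γ)` over the strategies of
Player II. -/
def worstValue (π : S.X → S.U) (x : S.X) : ℝ :=
  ⨆ γ : {γ : S.Adversary // S.IsAdversary γ}, S.J π γ.1 x

/-- `γ` is an optimal strategy of Player II against `π`. -/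
def IsOptimalAdversary (π : S.X → S.U) (γ : S.Adversary) : Prop :=
  S.IsAdversary γ ∧ ∀ x, ∀ γ', S.IsAdversary γ' → S.J π γ' x ≤ S.J π γ x

/-! ### The one-stage maximization problem and its finite-dimensional form -/

/-- The objective of the maximization over the ambiguity set in `(T^π v) (x)`. -/
def stageValue (π : S.X → S.U) (v : S.X → ℝ) (x : S.X) (μ : ProbabilityMeasure S.W) : ℝ :=
  S.c x (π x) + S.α * ∫ w, v (S.f x (π x) w) ∂(μ : Measure S.W)

/-- `μ` attains the supremum in `(T^π v) (x)`. -/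
def IsWorstDistribution (π : S.X → S.U) (v : S.X → ℝ) (x : S.X) (μ : ProbabilityMeasure S.W) :
    Prop :=
  μ ∈ S.ball ∧ IsMaxOn (S.stageValue π v x) S.ball μ

/-- The variables of the finite-dimensional problem: the lower atoms, the upper atoms, and the
weights `q` in the simplex of `ℝ²`. -/
abbrev Atoms : Type := (Fin N → S.W) × (Fin N → S.W) × stdSimplex ℝ (Fin 2)

/-- The feasible set of the finite-dimensional problem. -/
def feasible : Set S.Atoms :=
  {a | (1 / (N : ℝ)) * ∑ i, (a.2.2.1 0 * S.d (a.1 i) (S.sample i) ^ S.p +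
      a.2.2.1 1 * S.d (a.2.1 i) (S.sample i) ^ S.p) ≤ S.θ ^ S.p}

/-- The objective of the finite-dimensional problem. -/
def finiteValue (π : S.X → S.U) (v : S.X → ℝ) (x : S.X) (a : S.Atoms) : ℝ :=
  S.c x (π x) + S.α / (N : ℝ) * ∑ i, (a.2.2.1 0 * v (S.f x (π x) (a.1 i)) +
    a.2.2.1 1 * v (S.f x (π x) (a.2.1 i)))

/-- `a` is an optimal solution of the finite-dimensional problem. -/
def IsFiniteOptimal (π : S.X → S.U) (v : S.X → ℝ) (x : S.X) (a : S.Atoms) : Prop :=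
  a ∈ S.feasible ∧ IsMaxOn (S.finiteValue π v x) S.feasible a

/-- The measure `(1/N) ∑ i, (q₁ δ_{lower i} + q₂ δ_{upper i})`. -/
def atomicMeasure (a : S.Atoms) : Measure S.W :=
  (N : ℝ≥0∞)⁻¹ • ∑ i, (ENNReal.ofReal (a.2.2.1 0) • Measure.dirac (a.1 i) +
    ENNReal.ofReal (a.2.2.1 1) • Measure.dirac (a.2.1 i))

theorem isProbabilityMeasure_atomicMeasure (a : S.Atoms) :
    IsProbabilityMeasure (S.atomicMeasure a) := by
  obtain ⟨lo, hi, q, hq0, hq1⟩ := a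
  have hN : (N : ℝ≥0∞) ≠ 0 := by exact_mod_cast S.N_pos.ne'
  have hq : ENNReal.ofReal (q 0) + ENNReal.ofReal (q 1) = 1 := by
    rw [← ENNReal.ofReal_add (hq0 0) (hq0 1)]
    rw [Fin.sum_univ_two] at hq1
    rw [hq1, ENNReal.ofReal_one]
  refine ⟨?_⟩
  simp [atomicMeasure, hq, ENNReal.inv_mul_cancel hN (ENNReal.natCast_ne_top N)]

/-- `atomicMeasure` as a probability measure. -/
def atomic (a : S.Atoms) : ProbabilityMeasure S.W :=
  ⟨S.atomicMeasure a, S.isProbabilityMeasure_atomicMeasure a⟩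

end DRSystem

end

noncomputable section
open Filter Topology ProbabilityTheory

set_option synthInstance.maxSize 1000

/-! ### Analytic sets are universally measurable -/

/-! The obstacle is measurability: `v^π` is a supremum over strategies, with no regularity known in
advance, yet the Bellman argument must integrate it and select maximizers. Player II is therefore
first confined to decision trees, which assign a feasible point of the finite problem to every
finite sequence of branches (sample index, lower or upper atom). Trees form a standard Borel space
and the cost of a tree is Borel in (state, tree), so the superlevel sets of `treeSup` are
projections of Borel sets, hence analytic, hence universally measurable. Grafting and splitting
trees at the root shows that `treeSup` at `x` is the supremum of its own finite-dimensional problem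
(`finiteValue_le_treeSup`, `exists_lt_finiteValue`).

Atomic distributions lose nothing. A law in the ball has an optimal coupling with the sample,
because couplings are dominated by a multiple of the law itself and so have setwise limit points
(`exists_optimal_disintegration`). Disintegration gives one conditional law per sample point; on the
product of these laws, a planar Lagrange multiplier argument (`exists_two_point_ge`) replaces the
mean of (transport cost, value) by two tuples of atoms with a common weight (`exists_feasible_ge`).

Verification then identifies `treeSup` with `v^π`. Along an induced law, the discounted one-step
gaps `v(x_t) - c - α ∫ v dμ_t` have expectations summing to `v x` minus the cost. Nonnegative gaps
bound every strategy above (`IsInducedLaw.cost_le`); gaps at most `ε` bound a strategy below up to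
`ε / (1 - α)` (`IsInducedLaw.le_cost`). Jankov–von Neumann selection supplies stationary strategies
with gap at most `ε`, whence `worstValue_eq_treeSup`. Induced laws exist by Ionescu-Tulcea, applied
to Borel versions of the universally measurable kernels (`exists_inducedLaw`).

If the one-stage supremum is attained, the finite problem attains `treeSup x`, so the selection
works with `ε = 0`, which gives (i). Any optimal solution also reaches `treeSup x`, so its strategy
has no positive gap, which gives (ii). -/

theorem exists_measure_image_le_add {α : Type*} [MeasurableSpace α] (μ : Measure α)
    [IsFiniteMeasure μ] (f : (ℕ → ℕ) → α) (S : Set (ℕ → ℕ)) (n : ℕ) {δ : ℝ≥0∞} (hδ : δ ≠ 0) :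
    ∃ k, μ (f '' S) ≤ μ (f '' (S ∩ {z | z n ≤ k})) + δ := by
  have hU : f '' S = ⋃ k, f '' (S ∩ {z | z n ≤ k}) := by
    rw [← image_iUnion, ← inter_iUnion]
    congr 1
    refine (inter_eq_left.2 fun z _ => mem_iUnion.2 ⟨z n, le_refl (z n)⟩).symm
  have hm : Monotone fun k => f '' (S ∩ {z | z n ≤ k}) := fun i j hij =>
    image_mono (inter_subset_inter_right _ fun z (hz : z n ≤ i) => hz.trans hij)
  -- Continuity from below holds for arbitrary increasing sets; these images need not be measurable.
  have h := hm.measure_iUnion (μ := μ)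
  rw [← hU] at h
  by_contra! hc
  have hle : ⨆ k, μ (f '' (S ∩ {z | z n ≤ k})) ≤ μ (f '' S) - δ :=
    iSup_le fun k => ENNReal.le_sub_of_add_le_right
      (ne_top_of_le_ne_top (measure_ne_top μ (f '' S)) (le_of_add_le_right (hc k).le)) (hc k).le
  rw [← h] at hle
  have h0 : μ (f '' S) ≠ 0 := by
    intro h0
    simpa [h0] using hc 0
  exact absurd hle (not_le.2 (ENNReal.sub_lt_self (measure_ne_top μ _) h0 hδ))

/-- Bounding the coordinates one after another, each bound chosen for the set cut out so far and at
a loss `δ n`, leaves a compact box in Baire space. Its image is the intersection of the closures of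
the partially bounded images; these are measurable, so continuity from above passes the estimate to
the limit. -/
theorem exists_isCompact_subset_range {α : Type*} [TopologicalSpace α] [T2Space α]
    [MeasurableSpace α] [OpensMeasurableSpace α] (μ : Measure α) [IsFiniteMeasure μ]
    {f : (ℕ → ℕ) → α} (hf : Continuous f) {ε : ℝ≥0∞} (hε : ε ≠ 0) :
    ∃ K, IsCompact K ∧ K ⊆ range f ∧ μ (range f) ≤ μ K + ε := by
  obtain ⟨δ, hδ0, hδ⟩ := ENNReal.exists_pos_sum_of_countable' hε ℕ
  choose k hk using fun (S : Set (ℕ → ℕ)) (n : ℕ) =>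
    exists_measure_image_le_add μ f S n (hδ0 n).ne'
  let S : ℕ → Set (ℕ → ℕ) := fun n => Nat.rec univ (fun n S => S ∩ {z | z n ≤ k S n}) n
  have hS0 : S 0 = univ := rfl
  have hSs : ∀ n, S (n + 1) = S n ∩ {z | z n ≤ k (S n) n} := fun n => rfl
  have hSmem : ∀ n z, z ∈ S n ↔ ∀ i < n, z i ≤ k (S i) i := by
    intro n z
    induction n with
    | zero => simp [hS0]
    | succ n ih =>
      rw [hSs, mem_inter_iff, ih]
      refine ⟨fun h i hi => ?_, fun h => ⟨fun i hi => h i (by omega), h n (by omega)⟩⟩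
      rcases Nat.lt_succ_iff_lt_or_eq.1 hi with hi | rfl
      · exact h.1 i hi
      · exact h.2
  have hbound : ∀ n, μ (range f) ≤ μ (f '' S n) + ∑ i ∈ Finset.range n, δ i := by
    intro n
    induction n with
    | zero => simp [hS0]
    | succ n ih =>
      calc _ ≤ _ := ih
        _ ≤ _ := by
          rw [Finset.sum_range_succ, add_comm _ (δ n), ← add_assoc]
          gcongr
          exact hk (S n) n
  set K : Set (ℕ → ℕ) := Set.pi univ fun i => Set.Iic (k (S i) i) with hK
  have hKc : IsCompact K := isCompact_univ_pi fun i => (finite_Iic _).isCompact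
  have hInter : f '' K = ⋂ n, closure (f '' S n) := by
    apply Subset.antisymm
    · refine subset_iInter fun n => (image_mono fun z hz => ?_).trans subset_closure
      exact (hSmem n z).2 fun i _ => hz i (mem_univ i)
    · intro x hx
      by_contra hxK
      obtain ⟨U, V, hU, hV, hKU, hxV, hUV⟩ :=
        SeparatedNhds.of_isCompact_isCompact (hKc.image hf) (isCompact_singleton (x := x))
          (disjoint_singleton_right.2 hxK)
      have : ∃ n, f '' S n ⊆ U := by
        by_contra! hn
        have hn' : ∀ n, ∃ z ∈ S n, f z ∉ U := fun n => by
          obtain ⟨y, ⟨z, hz, rfl⟩, hy⟩ := not_subset.1 (hn n)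
          exact ⟨z, hz, hy⟩
        choose z hzS hzU using hn'
        -- Truncation moves the points into the compact box. Coordinate `i` of `z n` is unchanged
        -- once `n > i`, so the original points converge along the same subsequence.
        obtain ⟨w, hwK, φ, hφ, hlim⟩ := hKc.tendsto_subseq
          (x := fun n i => min (z n i) (k (S i) i))
          (fun n i _ => mem_Iic.2 (min_le_right (z n i) (k (S i) i)))
        have hlim' : Tendsto (fun n => z (φ n)) atTop (𝓝 w) := by
          rw [tendsto_pi_nhds] at hlim ⊢
          intro i
          refine (hlim i).congr' ?_
          filter_upwards [eventually_gt_atTop i] with n hn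
          exact min_eq_left ((hSmem _ _).1 (hzS (φ n)) i (hn.trans_le (hφ.id_le n)))
        have := (hf.tendsto w).comp hlim'
        obtain ⟨n, hn⟩ := (this.eventually (hU.mem_nhds (hKU ⟨w, hwK, rfl⟩))).exists
        exact hzU _ hn
      obtain ⟨n, hn⟩ := this
      have hxc := mem_iInter.1 hx n
      obtain ⟨y, hyV, hyU⟩ := mem_closure_iff.1 hxc V hV (hxV rfl)
      exact hUV.le_bot ⟨hn hyU, hyV⟩
  refine ⟨f '' K, hKc.image hf, image_subset_range _ _, ?_⟩
  have hanti : Antitone fun n => closure (f '' S n) := antitone_nat_of_succ_le fun n =>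
    closure_mono (image_mono (by rw [hSs]; exact inter_subset_left))
  rw [hInter, hanti.measure_iInter (fun n => isClosed_closure.measurableSet.nullMeasurableSet)
    ⟨0, measure_ne_top μ _⟩, ENNReal.iInf_add]
  refine le_iInf fun n => (hbound n).trans ?_
  gcongr
  · exact subset_closure
  · exact (ENNReal.sum_le_tsum _).trans hδ.le

/-- Compact subsets exhaust the outer measure of an analytic set, so it agrees almost everywhere
with a σ-compact subset. -/
theorem MeasureTheory.AnalyticSet.nullMeasurableSet {α : Type*} [TopologicalSpace α] [T2Space α]
    [MeasurableSpace α] [OpensMeasurableSpace α] {s : Set α} (hs : AnalyticSet s) (μ : Measure α)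
    [IsFiniteMeasure μ] : NullMeasurableSet s μ := by
  rw [AnalyticSet] at hs
  rcases hs with rfl | ⟨f, hf, rfl⟩
  · exact MeasurableSet.empty.nullMeasurableSet
  have h : ∀ n : ℕ, ∃ K, IsCompact K ∧ K ⊆ range f ∧ μ (range f) ≤ μ K + ((n : ℝ≥0∞) + 1)⁻¹ :=
    fun n => exists_isCompact_subset_range μ hf (ENNReal.inv_ne_zero.2 (by finiteness))
  choose K hKc hKs hKm using h
  have hU : MeasurableSet (⋃ n, K n) := MeasurableSet.iUnion fun n => (hKc n).measurableSet
  refine ⟨⋃ n, K n, hU, (ae_eq_of_subset_of_measure_ge (iUnion_subset hKs) ?_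
    hU.nullMeasurableSet (measure_ne_top μ _)).symm⟩
  have hlim : Tendsto (fun n : ℕ => μ (⋃ n, K n) + ((n : ℝ≥0∞) + 1)⁻¹) atTop
      (𝓝 (μ (⋃ n, K n) + 0)) := by
    refine Tendsto.const_add _ ?_
    have := (tendsto_add_atTop_iff_nat 1).2 ENNReal.tendsto_inv_nat_nhds_zero
    simpa using this
  rw [add_zero] at hlim
  refine ge_of_tendsto' hlim fun n => (hKm n).trans ?_
  gcongr
  exact subset_iUnion K n

/-! ### The Jankov–von Neumann selection theorem -/

/-- The prefix of length `n` of the lexicographically least branch through the sets `A l ∋ x`. -/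
def lexPrefix {α : Type*} (A : List ℕ → Set α) (x : α) : ℕ → List ℕ
  | 0 => []
  | n + 1 => lexPrefix A x n ++ [sInf {k | x ∈ A (lexPrefix A x n ++ [k])}]

/-- The lexicographically least branch through the sets `A l ∋ x`. -/
def lexBranch {α : Type*} (A : List ℕ → Set α) (x : α) (n : ℕ) : ℕ :=
  sInf {k | x ∈ A (lexPrefix A x n ++ [k])}

theorem lexPrefix_succ {α : Type*} (A : List ℕ → Set α) (x : α) (n : ℕ) :
    lexPrefix A x (n + 1) = lexPrefix A x n ++ [lexBranch A x n] := rfl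

theorem lexPrefix_eq_map {α : Type*} (A : List ℕ → Set α) (x : α) (n : ℕ) :
    lexPrefix A x n = (List.range n).map (lexBranch A x) := by
  induction n with
  | zero => rfl
  | succ n ih => rw [lexPrefix_succ, List.range_succ, List.map_append, ← ih]; rfl

theorem measurable_sInf_nat {α : Type*} [MeasurableSpace α] {A : ℕ → Set α}
    (hA : ∀ k, MeasurableSet (A k)) : Measurable fun x => sInf {k | x ∈ A k} := by
  refine measurable_to_countable' fun j => ?_
  -- Since `sInf ∅ = 0`, the value `0` is also taken at points that lie in no `A k`.
  have : (fun x => sInf {k | x ∈ A k}) ⁻¹' {j} =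
      (A j ∩ ⋂ i ∈ Finset.range j, (A i)ᶜ) ∪ ({_x | j = 0} ∩ ⋂ i, (A i)ᶜ) := by
    ext x
    simp only [mem_preimage, mem_singleton_iff, mem_union, mem_inter_iff, mem_iInter,
      Finset.mem_range, mem_compl_iff, mem_ofPred_eq]
    constructor
    · intro h
      by_cases hne : {k | x ∈ A k}.Nonempty
      · exact Or.inl ⟨h ▸ Nat.sInf_mem hne, fun i hi => Nat.notMem_of_lt_sInf (h ▸ hi)⟩
      · right
        rw [not_nonempty_iff_eq_empty] at hne
        rw [hne, Nat.sInf_empty] at h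
        exact ⟨h.symm, fun i hi => (eq_empty_iff_forall_notMem.1 hne) i hi⟩
    · rintro (⟨h1, h2⟩ | ⟨h1, h2⟩)
      · refine le_antisymm (Nat.sInf_le h1) ?_
        by_contra! hlt
        exact h2 _ hlt (Nat.sInf_mem (s := {k | x ∈ A k}) ⟨j, h1⟩)
      · have : {k | x ∈ A k} = ∅ := eq_empty_of_forall_notMem h2
        rw [this, h1, Nat.sInf_empty]
  rw [this]
  exact .union (.inter (hA _) (Finset.measurableSet_biInter _ fun i _ => (hA _).compl))
    (.inter (MeasurableSet.const _) (MeasurableSet.iInter fun i => (hA _).compl))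

theorem measurable_lexBranch {α : Type*} [MeasurableSpace α] {A : List ℕ → Set α}
    (hA : ∀ l, MeasurableSet (A l)) : Measurable (lexBranch A) := by
  let _ : MeasurableSpace (List ℕ) := ⊤
  have : DiscreteMeasurableSpace (List ℕ) := ⟨fun _ => trivial⟩
  have hnext : Measurable fun p : α × List ℕ => sInf {k | p.1 ∈ A (p.2 ++ [k])} :=
    measurable_from_prod_countable_left fun l => measurable_sInf_nat fun k => hA (l ++ [k])
  have hq : ∀ n, Measurable fun x => lexPrefix A x n := by
    intro n
    induction n with
    | zero => exact measurable_const
    | succ n ih =>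
      have h2 : Measurable fun p : List ℕ × ℕ => p.1 ++ [p.2] := measurable_of_countable _
      exact h2.comp (ih.prodMk (hnext.comp (measurable_id.prodMk ih)))
  exact measurable_pi_iff.2 fun n => hnext.comp (measurable_id.prodMk (hq n))

/-- The selected preimage of `x` is the leftmost branch through the cylinders whose image contains
`x`. Each of its prefixes extends to a preimage of `x`; these preimages converge to the branch, and
continuity of `ψ` shows that the branch itself maps to `x`. -/
theorem exists_lex_selection {α : Type*} [TopologicalSpace α] [T2Space α] [MeasurableSpace α]
    [OpensMeasurableSpace α] {ψ : (ℕ → ℕ) → α} (hψ : Continuous ψ) :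
    ∃ σ : α → ℕ → ℕ, (∀ x ∈ range ψ, ψ (σ x) = x) ∧
      ∀ μ : Measure α, IsFiniteMeasure μ → NullMeasurable σ μ := by
  let C : List ℕ → Set (ℕ → ℕ) := fun l => {z | (List.range l.length).map z = l}
  have hC : ∀ l, IsOpen (C l) := by
    intro l
    have : C l = ⋂ i ∈ Finset.range l.length, (fun z : ℕ → ℕ => z i) ⁻¹' {l.getD i 0} := by
      ext z
      simp only [C, mem_ofPred_eq, mem_iInter, Finset.mem_range, mem_preimage, mem_singleton_iff]
      constructor
      · intro h i hi
        have := congrArg (fun l => l.getD i 0) h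
        simpa [hi] using this
      · intro h
        apply List.ext_getElem (by simp)
        intro i h1 h2
        have := h i h2
        simpa [h2] using this
    rw [this]
    exact isOpen_biInter_finset fun i _ => (isOpen_discrete _).preimage (continuous_apply i)
  refine ⟨lexBranch fun l => ψ '' C l, fun x hx => ?_, fun μ hμ => ?_⟩
  · set A : List ℕ → Set α := fun l => ψ '' C l
    have hz : ∀ n, ∃ z, ψ z = x ∧ (List.range n).map z = lexPrefix A x n := by
      intro n
      induction n with
      | zero => obtain ⟨z, rfl⟩ := hx; exact ⟨z, rfl, rfl⟩
      | succ n ih =>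
        obtain ⟨z, hzx, hz⟩ := ih
        have hlen : ∀ k, (lexPrefix A x n ++ [k]).length = n + 1 := by
          simp [lexPrefix_eq_map]
        have hne : {k | x ∈ A (lexPrefix A x n ++ [k])}.Nonempty := by
          refine ⟨z n, z, ?_, hzx⟩
          rw [mem_ofPred_eq, hlen, List.range_succ, List.map_append, hz]; rfl
        obtain ⟨z', hz', hzx'⟩ := Nat.sInf_mem hne
        rw [mem_ofPred_eq, hlen] at hz'
        exact ⟨z', hzx', hz'⟩
    choose z hzx hz using hz
    have hlim : Tendsto z atTop (𝓝 (lexBranch A x)) := by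
      rw [tendsto_pi_nhds]
      intro i
      refine tendsto_const_nhds.congr' ?_
      filter_upwards [eventually_gt_atTop i] with n hn
      have h := hz n
      rw [lexPrefix_eq_map] at h
      exact (List.map_inj_left.1 h i (List.mem_range.2 hn)).symm
    have h1 := (hψ.tendsto _).comp hlim
    rw [show ψ ∘ z = fun _ => x from funext hzx] at h1
    exact tendsto_nhds_unique h1 tendsto_const_nhds
  -- Images of cylinders are analytic, hence measurable in the completed σ-algebra, and the branch
  -- is measurable with respect to them.
  · exact measurable_lexBranch (α := NullMeasurableSpace α μ) fun l =>
      ((hC l).analyticSet_image hψ).nullMeasurableSet μ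

/-- With `s` parametrized by Baire space, a selection for the first coordinate of the
parametrization yields `g` as the second coordinate at the selected parameter. -/
theorem MeasureTheory.AnalyticSet.exists_universallyMeasurable_selection {α β : Type*}
    [TopologicalSpace α] [T2Space α] [MeasurableSpace α] [OpensMeasurableSpace α]
    [TopologicalSpace β] [MeasurableSpace β] [BorelSpace β] [Nonempty β] {s : Set (α × β)}
    (hs : AnalyticSet s) :
    ∃ g : α → β, UniversallyMeasurable g ∧ ∀ x, (∃ y, (x, y) ∈ s) → (x, g x) ∈ s := by
  rw [AnalyticSet] at hs
  rcases hs with rfl | ⟨f, hf, rfl⟩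
  · exact ⟨fun _ => Classical.arbitrary β, fun P _ => measurable_const.nullMeasurable,
      fun x hx => by simp at hx⟩
  obtain ⟨σ, hσ, hσm⟩ := exists_lex_selection (continuous_fst.comp hf)
  refine ⟨fun x => (f (σ x)).2, fun P hP =>
    ((continuous_snd.comp hf).measurable).comp_nullMeasurable (hσm P inferInstance), ?_⟩
  rintro x ⟨y, z, hz⟩
  have hx : (f (σ x)).1 = x := hσ x ⟨z, by simp [hz]⟩
  exact ⟨σ x, Prod.ext hx rfl⟩

/-! ### Setwise limits of dominated measures -/

/-- Compactness of `ℝ≥0∞` gives a limit along `U` for every set at once, and this limit is finitely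
additive. Domination by `M • μ` makes the tails of a disjoint union small uniformly in `k`, which
yields countable additivity. No topology on `α` enters. -/
theorem Ultrafilter.exists_setwise_limit {α : Type*} [MeasurableSpace α] (U : Ultrafilter ℕ)
    (μ : Measure α) [IsFiniteMeasure μ] {M : ℝ≥0∞} (hM : M ≠ ∞) (P : ℕ → Measure α)
    (hP : ∀ k A, MeasurableSet A → P k A ≤ M * μ A) :
    ∃ Q : Measure α, ∀ A, MeasurableSet A → Tendsto (fun k => P k A) U (𝓝 (Q A)) := by
  let L : Set α → ℝ≥0∞ := fun A => (U.map fun k => P k A).lim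
  have hL : ∀ A, Tendsto (fun k => P k A) U (𝓝 (L A)) := fun A =>
    (U.map fun k => P k A).le_nhds_lim
  have hLM : ∀ A, MeasurableSet A → L A ≤ M * μ A := fun A hA =>
    le_of_tendsto' (hL A) fun k => hP k A hA
  have hunion : ∀ A B, MeasurableSet B → Disjoint A B → L (A ∪ B) = L A + L B := by
    intro A B hB hAB
    refine tendsto_nhds_unique (hL _) (((hL A).add (hL B)).congr fun k => ?_)
    exact (measure_union hAB hB).symm
  have hempty : L ∅ = 0 := tendsto_nhds_unique (hL ∅) (by simp)
  have hsum : ∀ f : ℕ → Set α, (∀ i, MeasurableSet (f i)) → Pairwise (Function.onFun Disjoint f) →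
      L (⋃ i, f i) = ∑' i, L (f i) := by
    intro f hf hd
    have hsplit : ∀ n, L (⋃ i, f i) = ∑ i ∈ Finset.range n, L (f i) + L (⋃ i, f (i + n)) := by
      intro n
      induction n with
      | zero => simp
      | succ n ih =>
        rw [ih, Finset.sum_range_succ, add_assoc, ← hunion _ _ (.iUnion fun i => hf _)]
        · congr 2
          have := Set.union_iUnion_nat_succ fun i => f (i + n)
          rw [← this, zero_add]
          congr 1
          exact iUnion_congr fun i => by rw [add_right_comm, add_assoc]
        · refine disjoint_iUnion_right.2 fun i => hd ?_
          omega
    have htail : Tendsto (fun n => L (⋃ i, f (i + n))) atTop (𝓝 0) := by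
      have hs : ∑' i, μ (f i) ≠ ∞ := by
        rw [← measure_iUnion hd hf]
        exact measure_ne_top _ _
      have h0 := ENNReal.Tendsto.const_mul (ENNReal.tendsto_sum_nat_add (fun i => μ (f i)) hs)
        (Or.inr hM)
      rw [mul_zero] at h0
      refine tendsto_of_tendsto_of_tendsto_of_le_of_le tendsto_const_nhds h0
        (fun _ => zero_le) fun n => (hLM _ (.iUnion fun i => hf _)).trans ?_
      gcongr
      exact measure_iUnion_le _
    have h1 : Tendsto (fun n => ∑ i ∈ Finset.range n, L (f i) + L (⋃ i, f (i + n))) atTop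
        (𝓝 (∑' i, L (f i) + 0)) := (ENNReal.tendsto_nat_tsum _).add htail
    rw [add_zero] at h1
    exact tendsto_nhds_unique (tendsto_const_nhds.congr hsplit) h1
  refine ⟨Measure.ofMeasurable (fun A _ => L A) hempty fun f hf hd => hsum f hf hd, ?_⟩
  intro A hA
  rw [Measure.ofMeasurable_apply A hA]
  exact hL A

/-- Integrals of simple functions converge under setwise convergence, and `∫⁻` is a supremum over
simple minorants, hence lower semicontinuous. -/
theorem sum_lintegral_le_of_setwise_limit {α ι : Type*} [MeasurableSpace α] [Fintype ι]
    (U : Ultrafilter ℕ) {P : ι → ℕ → Measure α} {Q : ι → Measure α}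
    (hQ : ∀ i A, MeasurableSet A → Tendsto (fun k => P i k A) U (𝓝 (Q i A)))
    (c : ι → α → ℝ≥0∞) {r : ℕ → ℝ≥0∞} {r₀ : ℝ≥0∞} (hr : Tendsto r U (𝓝 r₀))
    (hc : ∀ k, ∑ i, ∫⁻ w, c i w ∂P i k ≤ r k) : ∑ i, ∫⁻ w, c i w ∂Q i ≤ r₀ := by
  let ℓ : ι → ℝ≥0∞ := fun i => (U.map fun k => ∫⁻ w, c i w ∂P i k).lim
  have hℓ : ∀ i, Tendsto (fun k => ∫⁻ w, c i w ∂P i k) U (𝓝 (ℓ i)) := fun i =>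
    (U.map fun k => ∫⁻ w, c i w ∂P i k).le_nhds_lim
  calc ∑ i, ∫⁻ w, c i w ∂Q i ≤ ∑ i, ℓ i := Finset.sum_le_sum fun i _ => ?_
    _ ≤ r₀ := le_of_tendsto_of_tendsto' (tendsto_finsetSum _ fun i _ => hℓ i) hr hc
  rw [lintegral_eq_nnreal]
  refine iSup₂_le fun φ hφ => ?_
  have hlim : Tendsto (fun k => (φ.map ENNReal.ofNNReal).lintegral (P i k)) U
      (𝓝 ((φ.map ENNReal.ofNNReal).lintegral (Q i))) := by
    simp only [SimpleFunc.map_lintegral]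
    exact tendsto_finsetSum _ fun x _ => ENNReal.Tendsto.const_mul
      (hQ i _ (φ.measurableSet_preimage _)) (Or.inr ENNReal.coe_ne_top)
  refine le_of_tendsto_of_tendsto' hlim (hℓ i) fun k => ?_
  rw [← SimpleFunc.lintegral_eq_lintegral]
  exact lintegral_mono hφ

/-! ### Couplings with the empirical distribution -/

namespace DRSystem

variable {n m l N : ℕ} (S : DRSystem n m l N)

instance standardBorelSpace_X : StandardBorelSpace S.X := S.measurableSet_X.standardBorel

instance standardBorelSpace_W : StandardBorelSpace S.W := S.measurableSet_W.standardBorel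

instance nonempty_W : Nonempty S.W := ⟨S.sample ⟨0, S.N_pos⟩⟩

theorem d_self (w : S.W) : S.d w w = 0 := (S.d_eq_zero w w).2 rfl

theorem d_nonneg (w w' : S.W) : 0 ≤ S.d w w' := by
  have h := S.d_triangle w w' w
  rw [S.d_self, S.d_symm w' w] at h
  linarith

theorem p_pos : 0 < S.p := zero_lt_one.trans_le S.one_le_p

theorem natCast_N_ne_zero (S : DRSystem n m l N) : (N : ℝ≥0∞) ≠ 0 :=
  Nat.cast_ne_zero.2 S.N_pos.ne'

theorem measurable_d_sample (i : Fin N) : Measurable fun w => S.d w (S.sample i) ^ S.p :=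
  (S.measurable_d.comp (measurable_id.prodMk measurable_const)).pow_const _

theorem lintegral_empirical {g : S.W → ℝ≥0∞} :
    ∫⁻ w, g w ∂S.empirical = (N : ℝ≥0∞)⁻¹ * ∑ i, g (S.sample i) := by
  rw [empirical, lintegral_smul_measure, lintegral_finsetSum_measure, smul_eq_mul]
  simp

instance : IsProbabilityMeasure S.empirical := ⟨by
  rw [← lintegral_one, lintegral_empirical]
  simp [ENNReal.inv_mul_cancel S.natCast_N_ne_zero (ENNReal.natCast_ne_top N)]⟩

/-- A coupling of `μ` with the empirical distribution, disintegrated over the sample. -/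
theorem exists_disintegration {μ : Measure S.W} {κ : Measure (S.W × S.W)}
    (h₁ : κ.map Prod.fst = μ) (h₂ : κ.map Prod.snd = S.empirical) :
    ∃ P : Fin N → Measure S.W, (∀ i, IsProbabilityMeasure (P i)) ∧
      (∀ A, MeasurableSet A → ∑ i, P i A = N * μ A) ∧
      ∑ i, ∫⁻ w, ENNReal.ofReal (S.d w (S.sample i) ^ S.p) ∂P i =
        N * ∫⁻ z, ENNReal.ofReal (S.d z.1 z.2 ^ S.p) ∂κ := by
  have hκ : IsProbabilityMeasure κ := ⟨by
    rw [← preimage_univ (f := Prod.snd), ← Measure.map_apply measurable_snd .univ, h₂,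
      measure_univ]⟩
  -- The swap puts the sample coordinate first, so `condKernel` conditions on the sample point.
  -- Equal sample points simply receive the same conditional law.
  let κ' := κ.map Prod.swap
  have hκ' : IsProbabilityMeasure κ' := Measure.isProbabilityMeasure_map (by fun_prop)
  have hfst : κ'.fst = S.empirical := by
    rw [Measure.fst, Measure.map_map measurable_fst measurable_swap, ← h₂]; rfl
  have hdis := Measure.disintegrate κ' κ'.condKernel
  have key : ∀ F : S.W × S.W → ℝ≥0∞, Measurable F →
      ∑ i, ∫⁻ w, F (w, S.sample i) ∂κ'.condKernel (S.sample i) = N * ∫⁻ z, F z ∂κ := by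
    intro F hF
    have hFs : Measurable fun z : S.W × S.W => F z.swap := hF.comp measurable_swap
    have h : ∫⁻ z, F z ∂κ = ∫⁻ z, F z.swap ∂κ' := by
      exact (lintegral_map hFs measurable_swap).symm
    have h' : ∫⁻ z, F z.swap ∂κ' =
        ∫⁻ z, F z.swap ∂(κ'.fst.compProd κ'.condKernel) := by rw [hdis]
    rw [h, h', Measure.lintegral_compProd hFs, hfst,
      lintegral_empirical, ← mul_assoc,
      ENNReal.mul_inv_cancel S.natCast_N_ne_zero (ENNReal.natCast_ne_top N), one_mul]
    simp
  refine ⟨fun i => κ'.condKernel (S.sample i), fun i => inferInstance, fun A hA => ?_, ?_⟩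
  · have h := key (fun z => A.indicator 1 z.1) ((measurable_one.indicator hA).comp measurable_fst)
    rw [← h₁, Measure.map_apply measurable_fst hA, ← lintegral_indicator_one (measurable_fst hA)]
    rw [show (fun z : S.W × S.W => A.indicator (1 : S.W → ℝ≥0∞) z.1) =
      (Prod.fst ⁻¹' A).indicator 1 from rfl] at h
    rw [← h]
    exact Finset.sum_congr rfl fun i _ => (lintegral_indicator_one hA).symm
  · exact key (fun z => ENNReal.ofReal (S.d z.1 z.2 ^ S.p))
      (S.measurable_d.pow_const _).ennreal_ofReal

/-- The infimum in the Wasserstein distance to the empirical distribution is attained. -/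
theorem exists_optimal_disintegration {μ : ProbabilityMeasure S.W} (hμ : μ ∈ S.ball) :
    ∃ P : Fin N → Measure S.W, (∀ i, IsProbabilityMeasure (P i)) ∧
      (∀ A, MeasurableSet A → ∑ i, P i A = N * (μ : Measure S.W) A) ∧
      ∑ i, ∫⁻ w, ENNReal.ofReal (S.d w (S.sample i) ^ S.p) ∂P i ≤
        N * ENNReal.ofReal (S.θ ^ S.p) := by
  let ρ : ℕ → ℝ≥0∞ := fun k => ENNReal.ofReal S.θ + ((k : ℝ≥0∞) + 1)⁻¹
  have hρ : ∀ k, ∃ κ : Measure (S.W × S.W), (κ.map Prod.fst = μ ∧ κ.map Prod.snd = S.empirical) ∧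
      ∫⁻ z, ENNReal.ofReal (S.d z.1 z.2 ^ S.p) ∂κ ≤ ρ k ^ S.p := by
    intro k
    have hlt : S.wasserstein (μ : Measure S.W) S.empirical < ρ k :=
      lt_of_le_of_lt hμ (ENNReal.lt_add_right ENNReal.ofReal_ne_top
        (ENNReal.inv_ne_zero.2 (by finiteness)))
    simp only [wasserstein, iInf_lt_iff] at hlt
    obtain ⟨κ, hκ, hlt⟩ := hlt
    refine ⟨κ, hκ, ?_⟩
    have := ENNReal.rpow_le_rpow hlt.le S.p_pos.le
    rwa [← ENNReal.rpow_mul, one_div_mul_cancel S.p_pos.ne', ENNReal.rpow_one] at this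
  choose κ hκ hκρ using hρ
  choose P hPp hPμ hPc using fun k => S.exists_disintegration (hκ k).1 (hκ k).2
  -- The conditional laws sum to `N • μ`, so each is dominated by it. This replaces tightness, since
  -- `d` need not be related to the topology of `W`.
  have hdom : ∀ i k A, MeasurableSet A → P k i A ≤ N * (μ : Measure S.W) A := fun i k A hA =>
    (hPμ k A hA) ▸ Finset.single_le_sum (f := fun i => P k i A) (fun _ _ => zero_le)
      (Finset.mem_univ i)
  choose Q hQ using fun i => (hyperfilter ℕ).exists_setwise_limit (μ : Measure S.W)
    (ENNReal.natCast_ne_top N) (fun k => P k i) (hdom i)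
  refine ⟨Q, fun i => ⟨?_⟩, fun A hA => ?_, ?_⟩
  · exact tendsto_nhds_unique (hQ i univ .univ) (tendsto_const_nhds.congr fun k =>
      (hPp k i).measure_univ.symm)
  · exact tendsto_nhds_unique (tendsto_finsetSum _ fun i _ => hQ i A hA)
      (tendsto_const_nhds.congr fun k => (hPμ k A hA).symm)
  · refine sum_lintegral_le_of_setwise_limit (hyperfilter ℕ) hQ _
      (r := fun k => N * ρ k ^ S.p) ?_ fun k => ?_
    · have h0 : Tendsto ρ (hyperfilter ℕ) (𝓝 (ENNReal.ofReal S.θ + 0)) := by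
        refine Tendsto.const_add _ (Tendsto.mono_left ?_ Nat.hyperfilter_le_atTop)
        have := (tendsto_add_atTop_iff_nat 1).2 ENNReal.tendsto_inv_nat_nhds_zero
        simpa using this
      rw [add_zero] at h0
      rw [← ENNReal.ofReal_rpow_of_pos S.θ_pos]
      exact ENNReal.Tendsto.const_mul ((ENNReal.continuous_rpow_const.tendsto _).comp h0)
        (Or.inr (ENNReal.natCast_ne_top N))
    · rw [hPc k]
      gcongr
      exact hκρ k

end DRSystem

/-! ### Reduction to two atoms -/

/-- If no pair works, every chord from the left of `r` to its right passes below `V` at `r`. Then a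
line of slope `lam ≥ 0` through `(r, V)` lies above all points `(X, Y)`. Integrating forces almost
every point onto the line. Points of the line are found on both sides of `r`, and their chord passes
through `(r, V)`, a contradiction. Equality is reached without any closedness of the set of points.
-/
theorem exists_two_point_ge {Ω : Type*} [MeasurableSpace Ω] (P : Measure Ω)
    [IsProbabilityMeasure P] {X Y : Ω → ℝ} (hX : Integrable X P) (hY : Integrable Y P) {r V : ℝ}
    (hXr : ∫ ω, X ω ∂P ≤ r) (hYV : V ≤ ∫ ω, Y ω ∂P) :
    ∃ a b : Ω, ∃ q : ℝ, 0 ≤ q ∧ q ≤ 1 ∧ q * X a + (1 - q) * X b ≤ r ∧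
      V ≤ q * Y a + (1 - q) * Y b := by
  by_contra! hc
  have h1 : ∀ a, X a ≤ r → Y a < V := fun a ha => by
    simpa using hc a a 1 zero_le_one le_rfl (by simpa using ha)
  have h2 : ∀ a b, X a < r → r < X b → (Y b - V) * (r - X a) < (V - Y a) * (X b - r) := by
    intro a b ha hb
    have hab : 0 < X b - X a := by linarith
    -- This weight places the mixture of `X a` and `X b` exactly at `r`.
    have h := hc a b ((X b - r) / (X b - X a)) (div_nonneg (by linarith) hab.le)
      ((div_le_one hab).2 (by linarith))
      (le_of_eq (by field_simp; ring))
    have h' : (X b - r) / (X b - X a) * Y a + (1 - (X b - r) / (X b - X a)) * Y b =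
        ((X b - r) * Y a + (r - X a) * Y b) / (X b - X a) := by field_simp; ring
    rw [h', div_lt_iff₀ hab] at h
    nlinarith
  have hgt : ∀ g : Ω → ℝ, Integrable g P → (∀ᵐ ω ∂P, 0 < g ω) → 0 < ∫ ω, g ω ∂P := by
    intro g hg hpos
    refine (integral_pos_iff_support_of_nonneg_ae (hpos.mono fun _ h => h.le) hg).2 ?_
    have : P (Function.support g) = 1 := by
      rw [← measure_univ (μ := P)]
      exact measure_congr (eventuallyEq_univ.2 (hpos.mono fun _ h => h.ne'))
    simp [this]
  have hXi : ∫ ω, (X ω - r) ∂P = ∫ ω, X ω ∂P - r := by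
    rw [integral_sub hX (integrable_const _)]; simp
  have hYi : ∫ ω, (V - Y ω) ∂P = V - ∫ ω, Y ω ∂P := by
    rw [integral_sub (integrable_const _) hY]; simp
  by_cases hA : ∃ a, X a < r
  swap
  · push Not at hA
    have h0 : ∀ᵐ ω ∂P, X ω - r = 0 :=
      (integral_eq_zero_iff_of_nonneg (fun ω => sub_nonneg.2 (hA ω))
        (hX.sub (integrable_const r))).1 (le_antisymm (by rw [hXi]; linarith)
          (integral_nonneg fun ω => sub_nonneg.2 (hA ω)))
    have := hgt (fun ω => V - Y ω) ((integrable_const V).sub hY)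
      (h0.mono fun ω hω => sub_pos.2 (h1 ω (by linarith)))
    rw [hYi] at this
    linarith
  obtain ⟨a₀, ha₀⟩ := hA
  -- The slopes seen from the right of `r`; the extra `0` makes the multiplier nonnegative and
  -- covers the case of no point there.
  let B : Set ℝ := insert 0 ((fun b => (Y b - V) / (X b - r)) '' {b | r < X b})
  have hB : ∀ a, X a < r → ∀ t ∈ B, t ≤ (V - Y a) / (r - X a) := by
    rintro a ha t (rfl | ⟨b, hb, rfl⟩)
    · exact div_nonneg (sub_nonneg.2 (h1 a ha.le).le) (by linarith)
    · rw [div_le_div_iff₀ (sub_pos.2 hb) (sub_pos.2 ha)]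
      exact (h2 a b ha hb).le
  set lam := sSup B with hlam
  have hbdd : BddAbove B := ⟨_, hB a₀ ha₀⟩
  have hlam0 : 0 ≤ lam := le_csSup hbdd (mem_insert _ _)
  have hle : ∀ ω, 0 ≤ V + lam * (X ω - r) - Y ω := by
    intro ω
    rcases lt_trichotomy (X ω) r with h | h | h
    · have := csSup_le (insert_nonempty _ _) (hB ω h)
      rw [le_div_iff₀ (sub_pos.2 h)] at this
      linarith
    · have := h1 ω h.le
      rw [h]; linarith
    · have : (Y ω - V) / (X ω - r) ≤ lam := le_csSup hbdd (mem_insert_of_mem _ ⟨ω, h, rfl⟩)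
      rw [div_le_iff₀ (sub_pos.2 h)] at this
      linarith
  have hint : Integrable (fun ω => V + lam * (X ω - r) - Y ω) P :=
    ((integrable_const V).add ((hX.sub (integrable_const r)).const_mul lam)).sub hY
  have hval : ∫ ω, (V + lam * (X ω - r) - Y ω) ∂P =
      V + lam * (∫ ω, X ω ∂P - r) - ∫ ω, Y ω ∂P := by
    rw [integral_sub _ hY, integral_add (integrable_const V), integral_const_mul, hXi]
    · simp
    · exact (hX.sub (integrable_const r)).const_mul lam
    · exact (integrable_const V).add ((hX.sub (integrable_const r)).const_mul lam)
  have hnn : 0 ≤ ∫ ω, (V + lam * (X ω - r) - Y ω) ∂P := integral_nonneg hle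
  have hprod : lam * (∫ ω, X ω ∂P - r) ≤ 0 := mul_nonpos_of_nonneg_of_nonpos hlam0 (by linarith)
  have h0 : ∀ᵐ ω ∂P, V + lam * (X ω - r) - Y ω = 0 :=
    (integral_eq_zero_iff_of_nonneg hle hint).1 (le_antisymm (by rw [hval]; linarith) hnn)
  have hne : ∀ᵐ ω ∂P, X ω ≠ r := h0.mono fun ω hω h => by
    have := h1 ω h.le
    rw [h] at hω
    linarith
  have ha : ∃ a, X a < r ∧ V + lam * (X a - r) - Y a = 0 := by
    by_contra! hno
    have := hgt (fun ω => X ω - r) (hX.sub (integrable_const r)) (by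
      filter_upwards [h0, hne] with ω hω hn
      exact sub_pos.2 (lt_of_le_of_ne (not_lt.1 fun h => hno ω h hω) hn.symm))
    rw [hXi] at this
    linarith
  obtain ⟨a, har, ha⟩ := ha
  have hb : ∃ b, r < X b ∧ V + lam * (X b - r) - Y b = 0 := by
    by_contra! hno
    have := hgt (fun ω => r - X ω) ((integrable_const r).sub hX) (by
      filter_upwards [h0, hne] with ω hω hn
      exact sub_pos.2 (lt_of_le_of_ne (not_lt.1 fun h => hno ω h hω) hn))
    rw [integral_sub (integrable_const r) hX] at this
    simp only [integral_const, probReal_univ, smul_eq_mul, one_mul] at this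
    -- The constraint would be slack in the mean, so the multiplier vanishes (complementary
    -- slackness). The point `a` on the line would then have `Y a = V`, against `h1`.
    have hl0 : lam = 0 := by
      rw [hval] at hnn
      by_contra hl
      have hl' : 0 < lam := lt_of_le_of_ne hlam0 (Ne.symm hl)
      nlinarith
    have := h1 a har.le
    rw [hl0] at ha
    linarith
  obtain ⟨b, hbr, hb⟩ := hb
  have h := h2 a b har hbr
  rw [show Y b = V + lam * (X b - r) by linarith, show Y a = V + lam * (X a - r) by linarith] at h
  nlinarith

/-! ### Distributions in the ball and feasible atoms -/

namespace DRSystem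

variable {n m l N : ℕ} (S : DRSystem n m l N)

/-- Transport cost and value are both sums over the sample index, so they are real functions on
`W^N` under the product of the conditional laws. The two-point reduction is applied there once,
which is why a single pair of weights serves all `N` indices. -/
theorem exists_feasible_ge {μ : ProbabilityMeasure S.W} (hμ : μ ∈ S.ball) {h : S.W → ℝ}
    (hh : Integrable h (μ : Measure S.W)) :
    ∃ a ∈ S.feasible, ∫ w, h w ∂(μ : Measure S.W) ≤
      1 / (N : ℝ) * ∑ i, (a.2.2.1 0 * h (a.1 i) + a.2.2.1 1 * h (a.2.1 i)) := by
  obtain ⟨P, hP, hPμ, hPc⟩ := S.exists_optimal_disintegration hμ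
  have hN : (0 : ℝ) < N := Nat.cast_pos.2 S.N_pos
  have hsum : Measure.sum P = (N : ℝ≥0∞) • (μ : Measure S.W) := by
    ext A hA
    rw [Measure.sum_apply _ hA, tsum_fintype, hPμ A hA]; rfl
  rw [Measure.sum_fintype] at hsum
  have hhP : ∀ i, Integrable h (P i) := fun i => by
    refine Integrable.mono_measure (hh.smul_measure (ENNReal.natCast_ne_top N)) ?_
    rw [← hsum]
    exact Finset.single_le_sum (f := P) (fun j _ => Measure.zero_le (P j)) (Finset.mem_univ i)
  have hhsum : ∑ i, ∫ w, h w ∂P i = N * ∫ w, h w ∂(μ : Measure S.W) := by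
    rw [← integral_finsetSum_measure fun i _ => hhP i, hsum, integral_smul_measure]
    simp
  let k : Fin N → S.W → ℝ := fun i w => S.d w (S.sample i) ^ S.p
  have hk0 : ∀ i w, 0 ≤ k i w := fun i w => Real.rpow_nonneg (S.d_nonneg _ _) _
  have hfin : N * ENNReal.ofReal (S.θ ^ S.p) ≠ ∞ := by finiteness
  have hkP : ∀ i, Integrable (k i) (P i) := fun i => by
    refine ⟨(S.measurable_d_sample i).aestronglyMeasurable, ?_⟩
    rw [hasFiniteIntegral_iff_ofReal (ae_of_all _ (hk0 i))]
    exact (ENNReal.sum_ne_top.1 (ne_top_of_le_ne_top hfin hPc) i (Finset.mem_univ i)).lt_top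
  have hksum : ∑ i, ∫ w, k i w ∂P i ≤ N * S.θ ^ S.p := by
    have hθ : 0 ≤ S.θ ^ S.p := Real.rpow_nonneg S.θ_pos.le _
    have := ENNReal.toReal_mono hfin hPc
    rw [ENNReal.toReal_sum fun i _ => ENNReal.sum_ne_top.1 (ne_top_of_le_ne_top hfin hPc) i
      (Finset.mem_univ i), ENNReal.toReal_mul, ENNReal.toReal_ofReal hθ] at this
    refine le_trans (le_of_eq (Finset.sum_congr rfl fun i _ => ?_)) this
    exact integral_eq_lintegral_of_nonneg_ae (ae_of_all _ (hk0 i)) (hkP i).1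
  have heval : ∀ (g : Fin N → S.W → ℝ), (∀ i, Integrable (g i) (P i)) →
      Integrable (fun w : Fin N → S.W => ∑ i, g i (w i)) (Measure.pi P) ∧
        ∫ w, ∑ i, g i (w i) ∂Measure.pi P = ∑ i, ∫ w, g i w ∂P i := by
    intro g hg
    have hgi : ∀ i, Integrable (fun w : Fin N → S.W => g i (w i)) (Measure.pi P) := fun i =>
      (measurePreserving_eval P i).integrable_comp_of_integrable (hg i)
    refine ⟨integrable_finsetSum _ fun i _ => hgi i, ?_⟩
    rw [integral_finsetSum _ fun i _ => hgi i]
    exact Finset.sum_congr rfl fun i _ => integral_comp_eval (hg i).1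
  obtain ⟨hXi, hXe⟩ := heval k hkP
  obtain ⟨hYi, hYe⟩ := heval (fun _ => h) hhP
  obtain ⟨lo, hi, q, hq0, hq1, hX, hY⟩ := exists_two_point_ge (Measure.pi P) hXi hYi
    (r := N * S.θ ^ S.p) (V := N * ∫ w, h w ∂(μ : Measure S.W)) (hXe.trans_le hksum)
    (hYe.trans hhsum).ge
  refine ⟨(lo, hi, ⟨![q, 1 - q], ?_, ?_⟩), ?_, ?_⟩
  · intro i
    fin_cases i <;> simp [hq0, hq1]
  · simp
  · simp only [feasible, mem_ofPred_eq, Matrix.cons_val_zero, Matrix.cons_val_one,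
      Finset.sum_add_distrib, ← Finset.mul_sum]
    rw [one_div, inv_mul_le_iff₀ hN]
    exact hX
  · simp only [Matrix.cons_val_zero, Matrix.cons_val_one, Finset.sum_add_distrib, ← Finset.mul_sum]
    rw [one_div, le_inv_mul_iff₀ hN]
    exact hY

theorem stageValue_le_finiteValue {π : S.X → S.U} {v : S.X → ℝ} {x : S.X}
    {μ : ProbabilityMeasure S.W} (hμ : μ ∈ S.ball)
    (hv : Integrable (fun w => v (S.f x (π x) w)) (μ : Measure S.W)) :
    ∃ a ∈ S.feasible, S.stageValue π v x μ ≤ S.finiteValue π v x a := by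
  obtain ⟨a, ha, h⟩ := S.exists_feasible_ge hμ hv
  refine ⟨a, ha, ?_⟩
  have := mul_le_mul_of_nonneg_left h S.α_pos.le
  rw [stageValue, finiteValue, ← mul_one_div S.α (N : ℝ), mul_assoc]
  linarith

theorem atom_weight_nonneg (a : S.Atoms) (j : Fin 2) : 0 ≤ a.2.2.1 j := a.2.2.2.1 j

theorem lintegral_atomicMeasure (a : S.Atoms) (g : S.W → ℝ≥0∞) :
    ∫⁻ w, g w ∂S.atomicMeasure a = (N : ℝ≥0∞)⁻¹ * ∑ i, (ENNReal.ofReal (a.2.2.1 0) * g (a.1 i) +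
      ENNReal.ofReal (a.2.2.1 1) * g (a.2.1 i)) := by
  simp [atomicMeasure, lintegral_smul_measure, lintegral_finsetSum_measure]

theorem integral_atomicMeasure (a : S.Atoms) (g : S.W → ℝ) :
    ∫ w, g w ∂S.atomicMeasure a = 1 / (N : ℝ) * ∑ i, (a.2.2.1 0 * g (a.1 i) +
      a.2.2.1 1 * g (a.2.1 i)) := by
  have hint : ∀ (q : ℝ) (w : S.W), Integrable g (ENNReal.ofReal q • Measure.dirac w) := fun q w =>
    (integrable_dirac (by simp)).smul_measure ENNReal.ofReal_ne_top
  rw [atomicMeasure, integral_smul_measure, integral_finsetSum_measure fun i _ =>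
    (hint _ _).add_measure (hint _ _)]
  simp only [integral_add_measure (hint _ _) (hint _ _), integral_smul_measure, integral_dirac,
    ENNReal.toReal_ofReal (S.atom_weight_nonneg a _)]
  simp

theorem stageValue_atomic (π : S.X → S.U) (v : S.X → ℝ) (x : S.X) (a : S.Atoms) :
    S.stageValue π v x (S.atomic a) = S.finiteValue π v x a := by
  rw [stageValue, finiteValue, ← mul_one_div S.α (N : ℝ), mul_assoc]
  congr 2
  exact S.integral_atomicMeasure a _

/-- Pairing each atom with its own sample point is a coupling, and its cost is the left-hand side of
the feasibility constraint. -/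
theorem atomic_mem_ball {a : S.Atoms} (ha : a ∈ S.feasible) : S.atomic a ∈ S.ball := by
  let κ : Measure (S.W × S.W) := (N : ℝ≥0∞)⁻¹ • ∑ i,
    (ENNReal.ofReal (a.2.2.1 0) • Measure.dirac (a.1 i, S.sample i) +
      ENNReal.ofReal (a.2.2.1 1) • Measure.dirac (a.2.1 i, S.sample i))
  have hq : ENNReal.ofReal (a.2.2.1 0) + ENNReal.ofReal (a.2.2.1 1) = 1 := by
    rw [← ENNReal.ofReal_add (S.atom_weight_nonneg a 0) (S.atom_weight_nonneg a 1),
      ← Fin.sum_univ_two (f := a.2.2.1), a.2.2.2.2, ENNReal.ofReal_one]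
  have hlin : ∀ F : S.W × S.W → ℝ≥0∞, ∫⁻ z, F z ∂κ = (N : ℝ≥0∞)⁻¹ * ∑ i,
      (ENNReal.ofReal (a.2.2.1 0) * F (a.1 i, S.sample i) +
      ENNReal.ofReal (a.2.2.1 1) * F (a.2.1 i, S.sample i)) := fun F => by
    simp [κ, lintegral_smul_measure, lintegral_finsetSum_measure]
  have h1 : κ.map Prod.fst = S.atomicMeasure a := by
    refine Measure.ext_of_lintegral _ fun F hF => ?_
    rw [lintegral_map hF measurable_fst, hlin, lintegral_atomicMeasure]
  have h2 : κ.map Prod.snd = S.empirical := by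
    refine Measure.ext_of_lintegral _ fun F hF => ?_
    rw [lintegral_map hF measurable_snd, hlin, lintegral_empirical]
    simp [← add_mul, hq]
  have hmem : κ ∈ {κ : Measure (S.W × S.W) |
      κ.map Prod.fst = (S.atomic a : Measure S.W) ∧ κ.map Prod.snd = S.empirical} := ⟨h1, h2⟩
  change S.wasserstein (S.atomic a : Measure S.W) S.empirical ≤ _
  refine le_trans (b := (∫⁻ z, ENNReal.ofReal (S.d z.1 z.2 ^ S.p) ∂κ) ^ (1 / S.p))
    (iInf₂_le κ hmem) ?_
  have hN : (0 : ℝ) < N := Nat.cast_pos.2 S.N_pos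
  have hcost : ∫⁻ z, ENNReal.ofReal (S.d z.1 z.2 ^ S.p) ∂κ ≤ ENNReal.ofReal (S.θ ^ S.p) := by
    have hd : ∀ w i, 0 ≤ S.d w (S.sample i) ^ S.p := fun w i =>
      Real.rpow_nonneg (S.d_nonneg _ _) _
    have h0 := S.atom_weight_nonneg a
    rw [hlin]
    calc _ = ENNReal.ofReal (1 / (N : ℝ) * ∑ i,
          (a.2.2.1 0 * S.d (a.1 i) (S.sample i) ^ S.p +
            a.2.2.1 1 * S.d (a.2.1 i) (S.sample i) ^ S.p)) := by
          rw [ENNReal.ofReal_mul (by positivity), one_div, ENNReal.ofReal_inv_of_pos hN,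
            ENNReal.ofReal_natCast, ENNReal.ofReal_sum_of_nonneg fun i _ =>
              add_nonneg (mul_nonneg (h0 0) (hd _ _)) (mul_nonneg (h0 1) (hd _ _))]
          congr 1
          refine Finset.sum_congr rfl fun i _ => ?_
          rw [ENNReal.ofReal_add (mul_nonneg (h0 0) (hd _ _)) (mul_nonneg (h0 1) (hd _ _)),
            ENNReal.ofReal_mul (h0 0), ENNReal.ofReal_mul (h0 1)]
      _ ≤ _ := ENNReal.ofReal_le_ofReal ha
  calc _ ≤ ENNReal.ofReal (S.θ ^ S.p) ^ (1 / S.p) :=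
        ENNReal.rpow_le_rpow hcost (by have := S.p_pos; positivity)
    _ = ENNReal.ofReal S.θ := by
        rw [← ENNReal.ofReal_rpow_of_pos S.θ_pos, ← ENNReal.rpow_mul,
          mul_one_div_cancel S.p_pos.ne', ENNReal.rpow_one]

end DRSystem

/-! ### Universally measurable maps -/

/-- For a given law `P`, the inner map is replaced by a `P`-a.e. equal measurable version; the outer
map is then tested against the image law. -/
theorem UniversallyMeasurable.comp {α β γ : Type*} [MeasurableSpace α] [MeasurableSpace β]
    [MeasurableSpace.CountablyGenerated β] [MeasurableSpace γ] {f : β → γ} {g : α → β}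
    (hf : UniversallyMeasurable f) (hg : UniversallyMeasurable g) :
    UniversallyMeasurable (f ∘ g) := by
  intro P hP
  have hga : AEMeasurable g P := (hg P hP).aemeasurable
  have hQ : IsProbabilityMeasure (P.map (hga.mk g)) :=
    Measure.isProbabilityMeasure_map hga.measurable_mk.aemeasurable
  have hqmp : Measure.QuasiMeasurePreserving (hga.mk g) P (P.map (hga.mk g)) :=
    ⟨hga.measurable_mk, Measure.AbsolutelyContinuous.rfl⟩
  have h : NullMeasurable (f ∘ hga.mk g) P := fun s hs => (hf _ hQ hs).preimage hqmp
  exact h.congr (hga.ae_eq_mk.symm.fun_comp f)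

theorem Measurable.universallyMeasurable {α β : Type*} [MeasurableSpace α] [MeasurableSpace β]
    {f : α → β} (hf : Measurable f) : UniversallyMeasurable f :=
  fun _ _ => hf.nullMeasurable

theorem UniversallyMeasurable.comp_measurable {α β γ : Type*} [MeasurableSpace α]
    [MeasurableSpace β] [MeasurableSpace γ] {f : β → γ} {g : α → β}
    (hf : UniversallyMeasurable f) (hg : Measurable g) : UniversallyMeasurable (f ∘ g) := by
  intro P hP s hs
  exact (hf (P.map g) (Measure.isProbabilityMeasure_map hg.aemeasurable) hs).preimage
    ⟨hg, Measure.AbsolutelyContinuous.rfl⟩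

theorem Measurable.comp_universallyMeasurable {α β γ : Type*} [MeasurableSpace α]
    [MeasurableSpace β] [MeasurableSpace γ] {f : β → γ} {g : α → β}
    (hf : Measurable f) (hg : UniversallyMeasurable g) : UniversallyMeasurable (f ∘ g) :=
  fun P hP => hf.comp_nullMeasurable (hg P hP)

theorem UniversallyMeasurable.aestronglyMeasurable {α : Type*} [MeasurableSpace α] {f : α → ℝ}
    (hf : UniversallyMeasurable f) (P : Measure α) [hP : IsProbabilityMeasure P] :
    AEStronglyMeasurable f P :=
  (hf P hP).aemeasurable.aestronglyMeasurable

theorem universallyMeasurable_of_analyticSet_Ioi {α : Type*} [TopologicalSpace α] [T2Space α]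
    [MeasurableSpace α] [OpensMeasurableSpace α] {f : α → ℝ}
    (hf : ∀ r, AnalyticSet {x | r < f x}) : UniversallyMeasurable f := by
  intro P hP
  exact measurable_of_Ioi (δ := NullMeasurableSpace α P) fun r => (hf r).nullMeasurableSet P

namespace DRSystem

variable {n m l N : ℕ} (S : DRSystem n m l N)

/-! ### Averages over the atoms -/

/-- The atom of `a` at the branch `b`. -/
def atomAt (a : S.Atoms) (b : Fin N × Fin 2) : S.W := if b.2 = 0 then a.1 b.1 else a.2.1 b.1

/-- The weight of the branch `b` in the measure of `a`. -/
def weightAt (a : S.Atoms) (b : Fin N × Fin 2) : ℝ := 1 / (N : ℝ) * a.2.2.1 b.2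

theorem weightAt_nonneg (a : S.Atoms) (b : Fin N × Fin 2) : 0 ≤ S.weightAt a b :=
  mul_nonneg (by positivity) (S.atom_weight_nonneg a b.2)

theorem sum_weightAt_mul (a : S.Atoms) (g : S.W → ℝ) :
    ∑ b, S.weightAt a b * g (S.atomAt a b) = 1 / (N : ℝ) * ∑ i, (a.2.2.1 0 * g (a.1 i) +
      a.2.2.1 1 * g (a.2.1 i)) := by
  simp [Fintype.sum_prod_type, weightAt, atomAt, Finset.mul_sum, mul_add, mul_assoc]

theorem sum_weightAt (a : S.Atoms) : ∑ b, S.weightAt a b = 1 := by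
  have h := S.integral_atomicMeasure a fun _ => 1
  have := S.isProbabilityMeasure_atomicMeasure a
  rw [← S.sum_weightAt_mul a fun _ => 1] at h
  simpa using h.symm

theorem finiteValue_eq (π : S.X → S.U) (v : S.X → ℝ) (x : S.X) (a : S.Atoms) :
    S.finiteValue π v x a = S.c x (π x) +
      S.α * ∑ b, S.weightAt a b * v (S.f x (π x) (S.atomAt a b)) := by
  rw [S.sum_weightAt_mul a fun w => v (S.f x (π x) w), finiteValue, ← mul_one_div S.α (N : ℝ),
    mul_assoc]

theorem measurable_atomAt (b : Fin N × Fin 2) : Measurable fun a => S.atomAt a b := by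
  unfold atomAt
  split_ifs <;> fun_prop

theorem measurable_weight (j : Fin 2) : Measurable fun a : S.Atoms => a.2.2.1 j :=
  (measurable_pi_apply j).comp (measurable_subtype_coe.comp (measurable_snd.comp measurable_snd))

theorem measurable_weightAt (b : Fin N × Fin 2) : Measurable fun a => S.weightAt a b := by
  unfold weightAt
  exact (S.measurable_weight b.2).const_mul _

theorem measurableSet_feasible : MeasurableSet S.feasible := by
  refine measurableSet_le (Measurable.const_mul (Finset.measurable_sum _ fun i _ => ?_) _)
    measurable_const
  exact ((S.measurable_weight 0).mul ((S.measurable_d_sample i).comp (by fun_prop))).add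
    ((S.measurable_weight 1).mul ((S.measurable_d_sample i).comp (by fun_prop)))

instance standardBorelSpace_stdSimplex : StandardBorelSpace (stdSimplex ℝ (Fin 2)) :=
  (isClosed_stdSimplex ℝ (Fin 2)).measurableSet.standardBorel

instance standardBorelSpace_feasible : StandardBorelSpace S.feasible :=
  S.measurableSet_feasible.standardBorel

instance nonempty_feasible : Nonempty S.feasible := by
  refine ⟨⟨(S.sample, S.sample, ⟨![1, 0], ?_, ?_⟩), ?_⟩⟩
  · intro i
    fin_cases i <;> simp
  · simp
  · have := Real.rpow_nonneg S.θ_pos.le S.p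
    simpa [feasible, S.d_self, Real.zero_rpow S.p_pos.ne'] using this

/-! ### Consequences of the weight-function assumptions -/

variable {S} {ξ : S.X → ℝ} {b β : ℝ} {π : S.X → S.U}

theorem measurable_stageCost (hS : S.SemicontinuousModel ξ b β) (hπ : S.IsDetStationary π) :
    Measurable fun x => S.c x (π x) := by
  refine measurable_of_Ioi fun r => ?_
  -- Superlevel sets are only relatively open in `K`, but the graph of `π` lies in `K`.
  obtain ⟨O, hO, hOr⟩ := lowerSemicontinuousOn_iff_preimage_Ioi.1 hS.lsc_cost r
  have : (fun x => S.c x (π x)) ⁻¹' Ioi r = (fun x => (x, π x)) ⁻¹' O := by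
    ext x
    have hx : (x, π x) ∈ S.K := hπ.2 x
    have := Set.ext_iff.1 hOr (x, π x)
    simp only [mem_inter_iff, hx, true_and, mem_preimage] at this
    simpa using this
  rw [this]
  exact (measurable_id.prodMk hπ.1) hO.measurableSet

theorem measurable_dynamics (hπ : S.IsDetStationary π) :
    Measurable fun z : S.X × S.W => S.f z.1 (π z.1) z.2 :=
  S.measurable_f.comp (measurable_fst.prodMk ((hπ.1.comp measurable_fst).prodMk measurable_snd))

theorem abs_stageCost_le (hS : S.SemicontinuousModel ξ b β) (hπ : S.IsDetStationary π) (x : S.X) :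
    |S.c x (π x)| ≤ b * ξ x := hS.abs_cost_le (x, π x) (hπ.2 x)

theorem sum_weightAt_mul_weight_le (hS : S.SemicontinuousModel ξ b β) (hπ : S.IsDetStationary π)
    (x : S.X) {a : S.Atoms} (ha : a ∈ S.feasible) :
    ∑ i, S.weightAt a i * ξ (S.f x (π x) (S.atomAt a i)) ≤ β * ξ x := by
  rw [S.sum_weightAt_mul a fun w => ξ (S.f x (π x) w),
    ← S.integral_atomicMeasure a fun w => ξ (S.f x (π x) w)]
  exact hS.weight_le (S.atomic a) (S.atomic_mem_ball ha) (x, π x) (hπ.2 x)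

theorem discount_mul_nonneg (hS : S.SemicontinuousModel ξ b β) : 0 ≤ S.α * β :=
  mul_nonneg S.α_pos.le (zero_le_one.trans hS.one_le_β)

theorem discount_mul_lt_one (hS : S.SemicontinuousModel ξ b β) : S.α * β < 1 := by
  have := hS.β_lt
  rwa [lt_div_iff₀ S.α_pos, mul_comm] at this

/-! ### The value of a decision tree -/

variable (S) in
/-- Decision trees of Player II: a feasible point for every finite sequence of branches. -/
abbrev Tree : Type := List (Fin N × Fin 2) → S.feasible

/-- The subtree below the branch `i`. -/
def Tree.sub (y : S.Tree) (i : Fin N × Fin 2) : S.Tree := fun l => y (i :: l)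

/-- The tree with a given root and given subtrees. -/
def Tree.node (a : S.feasible) (ys : Fin N × Fin 2 → S.Tree) : S.Tree
  | [] => a
  | i :: l => ys i l

variable (π) in
/-- The expected discounted cost over `k` stages along a decision tree. -/
def treeCost : ℕ → S.X → S.Tree → ℝ
  | 0, _, _ => 0
  | k + 1, x, y => S.c x (π x) + S.α * ∑ i, S.weightAt (y []) i *
      treeCost k (S.f x (π x) (S.atomAt (y []) i)) (y.sub i)

variable (π) in
/-- The expected discounted cost along a decision tree. -/
def treeValue (x : S.X) (y : S.Tree) : ℝ := limUnder atTop fun k => treeCost π k x y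

theorem abs_sum_weightAt_mul_le (a : S.Atoms) {g h : Fin N × Fin 2 → ℝ} (hgh : ∀ i, |g i| ≤ h i) :
    |∑ i, S.weightAt a i * g i| ≤ ∑ i, S.weightAt a i * h i := by
  refine (Finset.abs_sum_le_sum_abs _ _).trans (Finset.sum_le_sum fun i _ => ?_)
  rw [abs_mul, abs_of_nonneg (S.weightAt_nonneg a i)]
  exact mul_le_mul_of_nonneg_left (hgh i) (S.weightAt_nonneg a i)

/-- Each stage multiplies the mean weight by at most `β` and the discount by `α`. The geometric
ratio `α β < 1` gives both convergence and a bound by a multiple of `ξ`. -/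
theorem dist_treeCost_succ_le (hS : S.SemicontinuousModel ξ b β) (hπ : S.IsDetStationary π)
    (k : ℕ) (x : S.X) (y : S.Tree) :
    dist (treeCost π k x y) (treeCost π (k + 1) x y) ≤ b * ξ x * (S.α * β) ^ k := by
  induction k generalizing x y with
  | zero => simpa [treeCost, Real.dist_eq] using abs_stageCost_le hS hπ x
  | succ k ih =>
    rw [treeCost, treeCost, Real.dist_eq, add_sub_add_left_eq_sub, ← mul_sub,
      ← Finset.sum_sub_distrib, abs_mul, abs_of_pos S.α_pos]
    simp only [← mul_sub]
    calc _ ≤ S.α * ∑ i, S.weightAt (y []) i *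
          (b * ξ (S.f x (π x) (S.atomAt (y []) i)) * (S.α * β) ^ k) := by
          refine mul_le_mul_of_nonneg_left (abs_sum_weightAt_mul_le _ fun i => ?_) S.α_pos.le
          rw [← Real.dist_eq]
          exact ih _ _
      _ = S.α * (b * (S.α * β) ^ k *
          ∑ i, S.weightAt (y []) i * ξ (S.f x (π x) (S.atomAt (y []) i))) := by
          rw [Finset.mul_sum _ _ (b * (S.α * β) ^ k)]
          congr 1
          exact Finset.sum_congr rfl fun i _ => by ring
      _ ≤ S.α * (b * (S.α * β) ^ k * (β * ξ x)) := by
          refine mul_le_mul_of_nonneg_left (mul_le_mul_of_nonneg_left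
            (sum_weightAt_mul_weight_le hS hπ x (y []).2) ?_) S.α_pos.le
          exact mul_nonneg hS.b_nonneg (pow_nonneg (discount_mul_nonneg hS) _)
      _ = _ := by ring

theorem tendsto_treeCost (hS : S.SemicontinuousModel ξ b β) (hπ : S.IsDetStationary π)
    (x : S.X) (y : S.Tree) :
    Tendsto (fun k => treeCost π k x y) atTop (𝓝 (treeValue π x y)) :=
  (cauchySeq_of_le_geometric _ _ (discount_mul_lt_one hS) fun k =>
    dist_treeCost_succ_le hS hπ k x y).tendsto_limUnder

theorem abs_treeValue_le (hS : S.SemicontinuousModel ξ b β) (hπ : S.IsDetStationary π)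
    (x : S.X) (y : S.Tree) : |treeValue π x y| ≤ b / (1 - S.α * β) * ξ x := by
  have := dist_le_of_le_geometric_of_tendsto₀ _ _ (discount_mul_lt_one hS)
    (fun k => dist_treeCost_succ_le hS hπ k x y) (tendsto_treeCost hS hπ x y)
  rw [treeCost, dist_zero_left, Real.norm_eq_abs] at this
  rwa [div_mul_eq_mul_div]

theorem treeValue_eq (hS : S.SemicontinuousModel ξ b β) (hπ : S.IsDetStationary π)
    (x : S.X) (y : S.Tree) :
    treeValue π x y = S.c x (π x) + S.α * ∑ i, S.weightAt (y []) i *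
      treeValue π (S.f x (π x) (S.atomAt (y []) i)) (y.sub i) :=
  tendsto_nhds_unique ((tendsto_add_atTop_iff_nat 1).2 (tendsto_treeCost hS hπ x y))
    (((tendsto_finsetSum _ fun _ _ => (tendsto_treeCost hS hπ _ _).const_mul _).const_mul _
      ).const_add _)

theorem Tree.measurable_sub (i : Fin N × Fin 2) : Measurable fun y : S.Tree => y.sub i :=
  measurable_pi_iff.2 fun l => measurable_pi_apply (i :: l)

theorem measurable_treeCost (hS : S.SemicontinuousModel ξ b β) (hπ : S.IsDetStationary π) (k : ℕ) :
    Measurable fun z : S.X × S.Tree => treeCost π k z.1 z.2 := by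
  induction k with
  | zero => exact measurable_const
  | succ k ih =>
    have hroot : Measurable fun z : S.X × S.Tree => (z.2 [] : S.Atoms) :=
      measurable_subtype_coe.comp ((measurable_pi_apply _).comp measurable_snd)
    refine ((measurable_stageCost hS hπ).comp measurable_fst).add
      (Measurable.const_mul (Finset.measurable_sum _ fun i _ => ?_) _)
    refine ((S.measurable_weightAt i).comp hroot).mul (ih.comp (Measurable.prodMk ?_
      ((Tree.measurable_sub i).comp measurable_snd)))
    exact (measurable_dynamics hπ).comp
      (measurable_fst.prodMk ((S.measurable_atomAt i).comp hroot))

theorem measurable_treeValue (hS : S.SemicontinuousModel ξ b β) (hπ : S.IsDetStationary π) :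
    Measurable fun z : S.X × S.Tree => treeValue π z.1 z.2 :=
  measurable_of_tendsto_metrizable (measurable_treeCost hS hπ)
    (tendsto_pi_nhds.2 fun z => tendsto_treeCost hS hπ z.1 z.2)

/-! ### The optimal value over decision trees -/

variable (π) in
/-- The supremum of the costs over decision trees. -/
def treeSup (x : S.X) : ℝ := ⨆ y : S.Tree, treeValue π x y

theorem bddAbove_treeValue (hS : S.SemicontinuousModel ξ b β) (hπ : S.IsDetStationary π)
    (x : S.X) : BddAbove (range fun y : S.Tree => treeValue π x y) :=
  ⟨_, forall_mem_range.2 fun y => (le_abs_self _).trans (abs_treeValue_le hS hπ x y)⟩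

theorem treeValue_le_treeSup (hS : S.SemicontinuousModel ξ b β) (hπ : S.IsDetStationary π)
    (x : S.X) (y : S.Tree) : treeValue π x y ≤ treeSup π x :=
  le_ciSup (bddAbove_treeValue hS hπ x) y

theorem abs_treeSup_le (hS : S.SemicontinuousModel ξ b β) (hπ : S.IsDetStationary π)
    (x : S.X) : |treeSup π x| ≤ b / (1 - S.α * β) * ξ x := by
  refine abs_le.2 ⟨?_, ciSup_le fun y => (abs_le.1 (abs_treeValue_le hS hπ x y)).2⟩
  exact (abs_le.1 (abs_treeValue_le hS hπ x (Classical.arbitrary S.Tree))).1.trans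
    (treeValue_le_treeSup hS hπ x _)

/-- This is the purpose of the trees: they form a standard Borel space, so the superlevel sets are
projections of Borel sets. -/
theorem universallyMeasurable_treeSup (hS : S.SemicontinuousModel ξ b β)
    (hπ : S.IsDetStationary π) : UniversallyMeasurable (treeSup (S := S) π) := by
  refine universallyMeasurable_of_analyticSet_Ioi fun r => ?_
  have : {x : S.X | r < treeSup π x} =
      Prod.fst '' {z : S.X × S.Tree | r < treeValue π z.1 z.2} := by
    ext x
    simp only [mem_ofPred_eq, mem_image, Prod.exists, exists_and_right, exists_eq_right]
    exact ⟨fun h => exists_lt_of_lt_ciSup h,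
      fun ⟨y, hy⟩ => hy.trans_le (treeValue_le_treeSup hS hπ x y)⟩
  rw [this]
  exact (measurableSet_lt measurable_const (measurable_treeValue hS hπ)).analyticSet_image
    measurable_fst

variable (π) in
/-- The cost of choosing `a` and following given decision trees afterwards. -/
def branchValue (x : S.X) (a : S.Atoms) (ys : Fin N × Fin 2 → S.Tree) : ℝ :=
  S.c x (π x) + S.α * ∑ i, S.weightAt a i * treeValue π (S.f x (π x) (S.atomAt a i)) (ys i)

theorem sum_weightAt_mul_mono (a : S.Atoms) {g h : Fin N × Fin 2 → ℝ} (hgh : ∀ i, g i ≤ h i) :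
    ∑ i, S.weightAt a i * g i ≤ ∑ i, S.weightAt a i * h i :=
  Finset.sum_le_sum fun i _ => mul_le_mul_of_nonneg_left (hgh i) (S.weightAt_nonneg a i)

theorem branchValue_le_finiteValue (hS : S.SemicontinuousModel ξ b β) (hπ : S.IsDetStationary π)
    (x : S.X) (a : S.Atoms) (ys : Fin N × Fin 2 → S.Tree) :
    branchValue π x a ys ≤ S.finiteValue π (treeSup π) x a := by
  rw [finiteValue_eq, branchValue]
  have h := sum_weightAt_mul_mono a fun i =>
    treeValue_le_treeSup hS hπ (S.f x (π x) (S.atomAt a i)) (ys i)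
  exact add_le_add_right (mul_le_mul_of_nonneg_left h S.α_pos.le) _

theorem exists_lt_branchValue (x : S.X) (a : S.Atoms) {ε : ℝ} (hε : 0 < ε) :
    ∃ ys, S.finiteValue π (treeSup π) x a - ε < branchValue π x a ys := by
  have h : ∀ i, ∃ y : S.Tree, treeSup π (S.f x (π x) (S.atomAt a i)) - ε <
      treeValue π (S.f x (π x) (S.atomAt a i)) y := fun i =>
    exists_lt_of_lt_ciSup (sub_lt_self _ hε)
  choose ys hys using h
  refine ⟨ys, ?_⟩
  have h1 := sum_weightAt_mul_mono a fun i => (hys i).le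
  simp only [mul_sub, Finset.sum_sub_distrib, ← Finset.sum_mul, sum_weightAt, one_mul] at h1
  have h2 := mul_le_mul_of_nonneg_left h1 S.α_pos.le
  -- The weights sum to one, so a loss `ε` on every branch costs only `α ε` at the root; the strict
  -- inequality comes from here.
  have h3 : S.α * ε < ε := mul_lt_of_lt_one_left hε S.α_lt_one
  rw [mul_sub] at h2
  rw [finiteValue_eq, branchValue]
  linarith

theorem treeValue_eq_branchValue (hS : S.SemicontinuousModel ξ b β) (hπ : S.IsDetStationary π)
    (x : S.X) (y : S.Tree) : treeValue π x y = branchValue π x (y []) y.sub :=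
  treeValue_eq hS hπ x y

/-- Near-optimal subtrees are grafted below the root `a`. Together with `exists_lt_finiteValue`,
which splits a tree at its root, this is the dynamic programming equation for `treeSup`. -/
theorem finiteValue_le_treeSup (hS : S.SemicontinuousModel ξ b β) (hπ : S.IsDetStationary π)
    (x : S.X) {a : S.Atoms} (ha : a ∈ S.feasible) :
    S.finiteValue π (treeSup π) x a ≤ treeSup π x := by
  refine le_of_forall_pos_lt_add fun ε hε => ?_
  obtain ⟨ys, hys⟩ := exists_lt_branchValue (π := π) x a hε
  have := treeValue_le_treeSup hS hπ x (Tree.node ⟨a, ha⟩ ys)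
  rw [treeValue_eq_branchValue hS hπ] at this
  change branchValue π x a ys ≤ _ at this
  linarith

theorem exists_lt_finiteValue (hS : S.SemicontinuousModel ξ b β) (hπ : S.IsDetStationary π)
    {x : S.X} {r : ℝ} (hr : r < treeSup π x) :
    ∃ a ∈ S.feasible, r < S.finiteValue π (treeSup π) x a := by
  obtain ⟨y, hy⟩ := exists_lt_of_lt_ciSup hr
  rw [treeValue_eq_branchValue hS hπ] at hy
  exact ⟨y [], (y []).2, hy.trans_le (branchValue_le_finiteValue hS hπ _ _ _)⟩

theorem measurable_branchValue (hS : S.SemicontinuousModel ξ b β) (hπ : S.IsDetStationary π) :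
    Measurable fun z : S.X × S.Atoms × (Fin N × Fin 2 → S.Tree) =>
      branchValue π z.1 z.2.1 z.2.2 := by
  have ha : Measurable fun z : S.X × S.Atoms × (Fin N × Fin 2 → S.Tree) => z.2.1 :=
    measurable_fst.comp measurable_snd
  refine ((measurable_stageCost hS hπ).comp measurable_fst).add
    (Measurable.const_mul (Finset.measurable_sum _ fun i _ => ?_) _)
  refine ((S.measurable_weightAt i).comp ha).mul ((measurable_treeValue hS hπ).comp
    (Measurable.prodMk ?_ ((measurable_pi_apply i).comp (measurable_snd.comp measurable_snd))))
  exact (measurable_dynamics hπ).comp (measurable_fst.prodMk ((S.measurable_atomAt i).comp ha))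

/-- As `treeSup` is not known to be Borel, it is replaced by the values of explicit subtrees: the
set is a countable intersection, over slacks `1 / (k + 1)`, of projections of Borel sets. The level
`r` stays a free variable because the level needed later, `treeSup x - ε`, is only universally
measurable in `x`. -/
theorem analyticSet_le_finiteValue (hS : S.SemicontinuousModel ξ b β)
    (hπ : S.IsDetStationary π) :
    AnalyticSet {z : (S.X × ℝ) × S.Atoms |
      z.2 ∈ S.feasible ∧ z.1.2 ≤ S.finiteValue π (treeSup π) z.1.1 z.2} := by
  let G : ℕ → Set ((S.X × ℝ) × S.feasible × (Fin N × Fin 2 → S.Tree)) := fun k =>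
    {z | z.1.2 - 1 / ((k : ℝ) + 1) < branchValue π z.1.1 z.2.1 z.2.2}
  let pr : (S.X × ℝ) × S.feasible × (Fin N × Fin 2 → S.Tree) → (S.X × ℝ) × S.Atoms :=
    fun z => (z.1, z.2.1)
  have hpr : Measurable pr := by fun_prop
  have hG : ∀ k, MeasurableSet (G k) := fun k => by
    refine measurableSet_lt (by fun_prop) ((measurable_branchValue hS hπ).comp
      (f := fun z : (S.X × ℝ) × S.feasible × (Fin N × Fin 2 → S.Tree) =>
        (z.1.1, (z.2.1 : S.Atoms), z.2.2)) (by fun_prop))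
  have : {z : (S.X × ℝ) × S.Atoms |
      z.2 ∈ S.feasible ∧ z.1.2 ≤ S.finiteValue π (treeSup π) z.1.1 z.2} =
      ⋂ k, pr '' G k := by
    ext ⟨⟨x, r⟩, a⟩
    simp only [mem_ofPred_eq, mem_iInter, mem_image]
    constructor
    · rintro ⟨ha, hr⟩ k
      obtain ⟨ys, hys⟩ := exists_lt_branchValue (π := π) x a (Nat.one_div_pos_of_nat (n := k))
      exact ⟨((x, r), ⟨a, ha⟩, ys), lt_of_le_of_lt (sub_le_sub_right hr _) hys, rfl⟩
    · intro h
      have key : ∀ k : ℕ, a ∈ S.feasible ∧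
          r - 1 / ((k : ℝ) + 1) ≤ S.finiteValue π (treeSup π) x a := by
        intro k
        obtain ⟨⟨⟨x', r'⟩, a', ys⟩, hz, he⟩ := h k
        simp only [pr, Prod.mk.injEq] at he
        obtain ⟨⟨rfl, rfl⟩, rfl⟩ := he
        exact ⟨a'.2, le_of_lt (lt_of_lt_of_le hz (branchValue_le_finiteValue hS hπ _ _ _))⟩
      refine ⟨(key 0).1, le_of_tendsto' (f := fun k : ℕ => r - 1 / ((k : ℝ) + 1)) (x := atTop) ?_
        fun k => (key k).2⟩
      simpa using tendsto_one_div_add_atTop_nhds_zero_nat.const_sub r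
  rw [this]
  exact AnalyticSet.iInter fun k => (hG k).analyticSet_image hpr

/-- A universally measurable choice of feasible points of value at least `r`. -/
theorem exists_selection (hS : S.SemicontinuousModel ξ b β) (hπ : S.IsDetStationary π) :
    ∃ g : S.X × ℝ → S.Atoms, UniversallyMeasurable g ∧ ∀ x r,
      (∃ a ∈ S.feasible, r ≤ S.finiteValue π (treeSup π) x a) →
        g (x, r) ∈ S.feasible ∧ r ≤ S.finiteValue π (treeSup π) x (g (x, r)) := by
  have : Nonempty S.Atoms := ⟨(Classical.arbitrary S.feasible).1⟩
  obtain ⟨g, hg, h⟩ := (analyticSet_le_finiteValue hS hπ).exists_universallyMeasurable_selection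
  exact ⟨g, hg, fun x r hr => h (x, r) hr⟩

end DRSystem

/-! ### The measurable space of probability measures -/

theorem exists_countable_piSystem (α : Type*) [m : MeasurableSpace α]
    [MeasurableSpace.CountablyGenerated α] :
    ∃ C : Set (Set α), C.Countable ∧ IsPiSystem C ∧ m = MeasurableSpace.generateFrom C :=
  ⟨generateSetAlgebra (MeasurableSpace.countableGeneratingSet α),
    countable_generateSetAlgebra MeasurableSpace.countable_countableGeneratingSet,
    fun _ hs _ ht _ => isSetAlgebra_generateSetAlgebra.inter_mem hs ht,
    by rw [generateFrom_generateSetAlgebra_eq,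
      MeasurableSpace.generateFrom_countableGeneratingSet]⟩

theorem ProbabilityMeasure.measurable_toMeasure_apply {α : Type*} [MeasurableSpace α] {A : Set α}
    (hA : MeasurableSet A) :
    Measurable fun μ : ProbabilityMeasure α => (μ : Measure α) A :=
  (Measure.measurable_coe hA).comp measurable_subtype_coe

/-- Evaluations on a countable generating π-system separate probability measures and generate their
σ-algebra. Hence this space is countably generated, as measurable versions of kernels require, and
has measurable points, as Dirac strategies require. -/
theorem ProbabilityMeasure.exists_countable_eval (α : Type*) [MeasurableSpace α]
    [MeasurableSpace.CountablyGenerated α] :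
    ∃ C : Set (Set α), C.Countable ∧ ∃ ev : ProbabilityMeasure α → C → ℝ≥0∞,
      Function.Injective ev ∧ (inferInstance : MeasurableSpace (ProbabilityMeasure α)) =
        MeasurableSpace.comap ev inferInstance := by
  obtain ⟨C, hC, hpi, hgen⟩ := exists_countable_piSystem α
  have hCm : ∀ A ∈ C, MeasurableSet A := fun A hA => by
    rw [hgen]
    exact MeasurableSpace.measurableSet_generateFrom hA
  let ev : ProbabilityMeasure α → C → ℝ≥0∞ := fun μ A => (μ : Measure α) A
  refine ⟨C, hC, ev, fun μ ν h => ?_, le_antisymm ?_ ?_⟩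
  · have hμ := μ.2
    exact Subtype.ext (ext_of_generate_finite (μ := (μ : Measure α)) C hgen hpi
      (fun A hA => congrFun h ⟨A, hA⟩) (by simp))
  · rintro _ ⟨s, hs, rfl⟩
    have hval : @Measurable _ _ (MeasurableSpace.comap ev inferInstance) _
        fun μ : ProbabilityMeasure α => (μ : Measure α) :=
      @Measurable.measure_of_isPiSystem_of_isProbabilityMeasure _ _
        (MeasurableSpace.comap ev inferInstance) _ _ (fun μ => μ.2) C hgen hpi fun A hA =>
          (measurable_pi_apply (⟨A, hA⟩ : C)).comp (comap_measurable ev)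
    exact hval hs
  · rw [← measurable_iff_comap_le]
    exact measurable_pi_iff.2 fun A => ProbabilityMeasure.measurable_toMeasure_apply (hCm A A.2)

instance ProbabilityMeasure.countablyGenerated {α : Type*} [MeasurableSpace α]
    [MeasurableSpace.CountablyGenerated α] :
    MeasurableSpace.CountablyGenerated (ProbabilityMeasure α) := by
  obtain ⟨C, hC, ev, -, hev⟩ := ProbabilityMeasure.exists_countable_eval α
  have := hC.to_subtype
  simp only [inferInstance] at hev
  rw [hev]
  exact MeasurableSpace.CountablyGenerated.comap ev

instance ProbabilityMeasure.measurableSingletonClass {α : Type*} [MeasurableSpace α]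
    [MeasurableSpace.CountablyGenerated α] :
    MeasurableSingletonClass (ProbabilityMeasure α) := by
  obtain ⟨C, hC, ev, hinj, hev⟩ := ProbabilityMeasure.exists_countable_eval α
  have := hC.to_subtype
  refine ⟨fun μ => ?_⟩
  have h : {μ} = ev ⁻¹' {ev μ} := by
    ext ν
    simp [hinj.eq_iff]
  simp only [inferInstance] at hev
  rw [h, hev]
  exact ⟨_, measurableSet_singleton _, rfl⟩

/-! ### Measurable versions of universally measurable kernels -/

/-- On a countable π-system all evaluations of `γ` agree with measurable versions off one null set
`Z`. Keeping `γ` off `Z` and a Dirac mass on `Z` gives a measurable kernel, since the π-system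
determines measurability. -/
theorem exists_kernel_ae_eq {H E : Type*} [MeasurableSpace H] [MeasurableSpace E]
    [MeasurableSpace.CountablyGenerated E] [Nonempty E] {γ : H → Measure E}
    (hγ : UniversallyMeasurable γ) (hp : ∀ h, IsProbabilityMeasure (γ h)) (Q : Measure H) :
    ∃ κ : Kernel H E, IsMarkovKernel κ ∧ (IsProbabilityMeasure Q → ∀ᵐ h ∂Q, κ h = γ h) := by
  classical
  by_cases hQ : IsProbabilityMeasure Q
  swap
  -- A default for other measures `Q` lets the version be chosen as a total function of `Q`.
  · exact ⟨Kernel.const H (Measure.dirac (Classical.arbitrary E)), inferInstance,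
      fun h => absurd h hQ⟩
  obtain ⟨C, hC, hpi, hgen⟩ := exists_countable_piSystem E
  have hae : ∀ A ∈ C, AEMeasurable (fun h => γ h A) Q := fun A hA => by
    have hAm : MeasurableSet A := by
      rw [hgen]
      exact MeasurableSpace.measurableSet_generateFrom hA
    exact ((Measure.measurable_coe hAm).comp_nullMeasurable (hγ Q hQ)).aemeasurable
  let bad : Set H := {h | ¬ ∀ A (hA : A ∈ C), γ h A = (hae A hA).mk _ h}
  have hbad : Q bad = 0 := (ae_ball_iff hC).2 fun A hA => (hae A hA).ae_eq_mk
  let Z := toMeasurable Q bad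
  have hZ : MeasurableSet Z := measurableSet_toMeasurable _ _
  have hZ0 : Q Z = 0 := by rw [measure_toMeasurable, hbad]
  let κ : H → Measure E := fun h =>
    if h ∈ Z then Measure.dirac (Classical.arbitrary E) else γ h
  have hκp : ∀ h, IsProbabilityMeasure (κ h) := fun h => by
    by_cases hh : h ∈ Z
    · simp only [κ, if_pos hh]; infer_instance
    · simp only [κ, if_neg hh]; exact hp h
  have hκ : Measurable κ := by
    refine Measurable.measure_of_isPiSystem_of_isProbabilityMeasure hgen hpi fun A hA => ?_
    have : (fun h => κ h A) = fun h =>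
        if h ∈ Z then Measure.dirac (Classical.arbitrary E) A else (hae A hA).mk _ h := by
      ext h
      by_cases hh : h ∈ Z
      · simp only [κ, if_pos hh]
      · simp only [κ, if_neg hh]
        have : h ∉ bad := fun hb => hh (subset_toMeasurable Q bad hb)
        simp only [bad, mem_ofPred_eq, not_not] at this
        exact this A hA
    rw [this]
    exact Measurable.ite hZ measurable_const (hae A hA).measurable_mk
  refine ⟨⟨κ, hκ⟩, ⟨hκp⟩, fun _ => ?_⟩
  have hZae : ∀ᵐ h ∂Q, h ∉ Z := by simpa [ae_iff] using hZ0
  filter_upwards [hZae] with h hh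
  simp only [Kernel.coe_mk, κ, if_neg hh]

namespace DRSystem

variable {n m l N : ℕ} (S : DRSystem n m l N)

instance nonempty_probabilityMeasure : Nonempty (ProbabilityMeasure S.W) :=
  ⟨⟨S.empirical, inferInstance⟩⟩

/-! ### The transition kernel -/

/-- The disturbance law of a stage, as a kernel. -/
def noise : Kernel S.Stage S.W :=
  ⟨fun s => (s.2.2 : Measure S.W), measurable_subtype_coe.comp (measurable_snd.comp measurable_snd)⟩

instance : IsMarkovKernel S.noise := ⟨fun s => s.2.2.2⟩

theorem measurable_dynamics_stage :
    Measurable fun z : S.Stage × S.W => S.f z.1.1 z.1.2.1 z.2 :=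
  S.measurable_f.comp ((measurable_fst.comp measurable_fst).prodMk
    ((measurable_fst.comp (measurable_snd.comp measurable_fst)).prodMk measurable_snd))

/-- The law of the next state, given the current stage. -/
def nextState : Kernel S.Stage S.X :=
  (Kernel.id ×ₖ S.noise).map fun z => S.f z.1.1 z.1.2.1 z.2

theorem nextState_eq_map (s : S.Stage) :
    S.nextState s = (s.2.2 : Measure S.W).map (S.f s.1 s.2.1) := by
  have h : Measurable fun w : S.W => (s, w) := measurable_const.prodMk measurable_id
  rw [nextState, Kernel.map_apply _ S.measurable_dynamics_stage, Kernel.prod_apply, Kernel.id_apply,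
    Measure.dirac_prod, Measure.map_map S.measurable_dynamics_stage h]
  rfl

instance : IsMarkovKernel S.nextState := Kernel.IsMarkovKernel.map _ S.measurable_dynamics_stage

theorem measurable_f_stage (s : S.Stage) : Measurable (S.f s.1 s.2.1) :=
  S.measurable_f.comp (measurable_const.prodMk (measurable_const.prodMk measurable_id))

theorem nextState_apply (s : S.Stage) {B : Set S.X} (hB : MeasurableSet B) :
    S.nextState s B = (s.2.2 : Measure S.W) {w | S.f s.1 s.2.1 w ∈ B} := by
  rw [nextState_eq_map, Measure.map_apply (S.measurable_f_stage s) hB]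
  rfl

end DRSystem

theorem map_frestrictLe_zero_trajMeasure {X : ℕ → Type*} [∀ t, MeasurableSpace (X t)]
    (μ₀ : Measure (X 0)) [IsProbabilityMeasure μ₀]
    (κ : (t : ℕ) → Kernel (Π i : Finset.Iic t, X i) (X (t + 1))) [∀ t, IsMarkovKernel (κ t)] :
    (Kernel.trajMeasure μ₀ κ).map (Preorder.frestrictLe 0) =
      μ₀.map (MeasurableEquiv.piUnique fun i : Finset.Iic 0 => X i).symm := by
  rw [Kernel.trajMeasure, Measure.map_comp _ _ (by fun_prop), Kernel.traj_map_frestrictLe,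
    Kernel.partialTraj_self, Measure.id_comp]
  rfl

namespace DRSystem

variable {n m l N : ℕ} {S : DRSystem n m l N} {π : S.X → S.U}

/-! ### Existence of the law of the trajectory -/

variable (S) in
/-- Stages up to and including time `t`. -/
abbrev Upto (t : ℕ) : Type := Finset.Iic t → S.Stage

/-- The last stage. -/
def Upto.last {t : ℕ} (p : S.Upto t) : S.Stage := p ⟨t, Finset.mem_Iic.2 le_rfl⟩

/-- The stages before time `t + 1`. -/
def Upto.toPast {t : ℕ} (p : S.Upto t) : Fin (t + 1) → S.Stage :=
  fun i => p ⟨i, Finset.mem_Iic.2 (Nat.lt_succ_iff.1 i.2)⟩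

variable (π) in
/-- The extended history at time `t + 1`, given the stages up to time `t` and the next state. -/
def Upto.hist {t : ℕ} (z : S.Upto t × S.X) : S.HistE (t + 1) := (z.1.toPast, z.2, π z.2)

variable (π) in
/-- The next stage, given the next state and the next distribution. -/
def mkStage (z : S.X × ProbabilityMeasure S.W) : S.Stage := (z.1, π z.1, z.2)

theorem Upto.measurable_last (t : ℕ) : Measurable (Upto.last (S := S) (t := t)) :=
  measurable_pi_apply _

theorem Upto.measurable_toPast (t : ℕ) : Measurable (Upto.toPast (S := S) (t := t)) :=
  measurable_pi_iff.2 fun _ => measurable_pi_apply _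

theorem Upto.measurable_hist (hπ : Measurable π) (t : ℕ) :
    Measurable (Upto.hist π (t := t)) :=
  ((Upto.measurable_toPast t).comp measurable_fst).prodMk
    (measurable_snd.prodMk (hπ.comp measurable_snd))

theorem measurable_mkStage (hπ : Measurable π) : Measurable (mkStage π) :=
  measurable_fst.prodMk ((hπ.comp measurable_fst).prodMk measurable_snd)

/-- The law of the next state, given the stages up to time `t`. -/
def stateKernel (t : ℕ) : Kernel (S.Upto t) S.X := S.nextState.comap _ (Upto.measurable_last t)

instance (t : ℕ) : IsMarkovKernel (stateKernel (S := S) t) :=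
  inferInstanceAs (IsMarkovKernel (S.nextState.comap _ (Upto.measurable_last t)))

/-- The law of the next stage, given the stages up to time `t`. -/
def stepKernel (hπ : Measurable π) (t : ℕ)
    (κ : Kernel (S.HistE (t + 1)) (ProbabilityMeasure S.W)) : Kernel (S.Upto t) S.Stage :=
  (stateKernel t ⊗ₖ κ.comap _ (Upto.measurable_hist hπ t)).map (mkStage π)

instance (hπ : Measurable π) (t : ℕ) (κ : Kernel (S.HistE (t + 1)) (ProbabilityMeasure S.W))
    [IsMarkovKernel κ] : IsMarkovKernel (stepKernel hπ t κ) :=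
  Kernel.IsMarkovKernel.map _ (measurable_mkStage hπ)

theorem lintegral_stepKernel (hπ : Measurable π) (t : ℕ)
    (κ : Kernel (S.HistE (t + 1)) (ProbabilityMeasure S.W)) [IsMarkovKernel κ] (p : S.Upto t)
    {F : S.Stage → ℝ≥0∞} (hF : Measurable F) :
    ∫⁻ s, F s ∂stepKernel hπ t κ p =
      ∫⁻ x, ∫⁻ μ, F (x, π x, μ) ∂κ (Upto.hist π (p, x)) ∂S.nextState p.last := by
  have hF' : Measurable fun z => F (mkStage π z) := hF.comp (measurable_mkStage hπ)
  rw [stepKernel, Kernel.map_apply _ (measurable_mkStage hπ),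
    lintegral_map hF (measurable_mkStage hπ), Kernel.lintegral_compProd _ _ _ hF']
  rfl

/-- The trajectory that follows `p` up to time `t` and is constant afterwards. -/
def extend (t : ℕ) (z : S.Upto t × S.Stage) : S.Traj :=
  fun i => if h : i ≤ t then z.1 ⟨i, Finset.mem_Iic.2 h⟩ else z.2

theorem measurable_extend (t : ℕ) : Measurable (extend (S := S) t) := by
  refine measurable_pi_iff.2 fun i => ?_
  unfold extend
  by_cases h : i ≤ t
  · simp only [h, dite_true]
    exact (measurable_pi_apply _).comp measurable_fst
  · simp only [h, dite_false]
    exact measurable_snd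

/-- Approximations of the law of the trajectory: `approx t` has the right law up to time `t`. -/
def approx (hπ : Measurable π) (μ₀ : Measure S.Stage)
    (ver : ∀ t, Measure (S.HistE (t + 1)) → Kernel (S.HistE (t + 1)) (ProbabilityMeasure S.W)) :
    ℕ → Measure S.Traj
  | 0 => μ₀.map fun s _ => s
  | t + 1 => (((approx hπ μ₀ ver t).map (Preorder.frestrictLe t)) ⊗ₘ
      stepKernel hπ t (ver t ((((approx hπ μ₀ ver t).map (Preorder.frestrictLe t)) ⊗ₘ
        stateKernel t).map (Upto.hist π)))).map (extend t)

set_option maxHeartbeats 1000000 in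
-- The version used at time `t + 1` must fit the law of the history, which depends on the earlier
-- versions. The recursion `approx` breaks this circle; the trajectory measure of the resulting
-- kernels has the same marginals up to each time, so every version was chosen for the correct law.
theorem exists_trajectory_measure (hπ : Measurable π) (μ₀ : Measure S.Stage)
    [IsProbabilityMeasure μ₀]
    (ver : ∀ t, Measure (S.HistE (t + 1)) → Kernel (S.HistE (t + 1)) (ProbabilityMeasure S.W))
    (hver : ∀ t Q, IsMarkovKernel (ver t Q)) :
    ∃ P : Measure S.Traj, IsProbabilityMeasure P ∧ P.map (fun ω => ω 0) = μ₀ ∧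
      ∀ t, P.map (fun ω => (Preorder.frestrictLe t ω, ω (t + 1))) =
        P.map (Preorder.frestrictLe t) ⊗ₘ stepKernel hπ t
          (ver t ((P.map (Preorder.frestrictLe t) ⊗ₘ stateKernel t).map (Upto.hist π))) := by
  let Q : ∀ t, Measure (S.HistE (t + 1)) := fun t =>
    (((approx hπ μ₀ ver t).map (Preorder.frestrictLe t)) ⊗ₘ stateKernel t).map (Upto.hist π)
  let κ : ∀ t, Kernel (Finset.Iic t → S.Stage) S.Stage := fun t => stepKernel hπ t (ver t (Q t))
  have hκ : ∀ t, IsMarkovKernel (κ t) := fun t => by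
    have := hver t (Q t)
    infer_instance
  let P := Kernel.trajMeasure (X := fun _ => S.Stage) μ₀ κ
  have hstep : ∀ t, P.map (fun ω => (Preorder.frestrictLe t ω, ω (t + 1))) =
      P.map (Preorder.frestrictLe t) ⊗ₘ κ t := fun t =>
    (Kernel.map_frestrictLe_trajMeasure_compProd_eq_map_trajMeasure (X := fun _ => S.Stage)).symm
  have h0 : P.map (Preorder.frestrictLe 0) =
      μ₀.map (MeasurableEquiv.piUnique fun _ : Finset.Iic 0 => S.Stage).symm := by
    exact map_frestrictLe_zero_trajMeasure (X := fun _ => S.Stage) μ₀ κ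
  have hmarg : ∀ t, P.map (Preorder.frestrictLe t) =
      (approx hπ μ₀ ver t).map (Preorder.frestrictLe t) := by
    intro t
    induction t with
    | zero =>
      rw [h0, approx, Measure.map_map (by fun_prop) (by fun_prop)]
      rfl
    | succ t ih =>
      -- Past time `t`, `extend t` takes the new stage as its value, so it reproduces a trajectory
      -- up to time `t + 1`.
      have : (Preorder.frestrictLe (π := fun _ => S.Stage) (t + 1)) =
          (Preorder.frestrictLe (t + 1) ∘ extend t) ∘
            fun ω : S.Traj => (Preorder.frestrictLe t ω, ω (t + 1)) := by
        funext ω i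
        have hi : (i : ℕ) ≤ t + 1 := Finset.mem_Iic.1 i.2
        by_cases h : (i : ℕ) ≤ t
        · simp [extend, h]
        · have h' : (i : ℕ) = t + 1 := by omega
          simp [extend, h']
      rw [approx, Measure.map_map (by fun_prop) (measurable_extend t), ← ih]
      conv_lhs => rw [this]
      rw [← Measure.map_map ((by fun_prop : Measurable _).comp (measurable_extend t))
        (by fun_prop), hstep t]
      simp only [κ, Q, ih]
  refine ⟨P, by infer_instance, ?_, fun t => ?_⟩
  · have : (fun ω : S.Traj => ω 0) = (fun p : S.Upto 0 => p ⟨0, Finset.mem_Iic.2 le_rfl⟩) ∘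
        Preorder.frestrictLe 0 := rfl
    rw [this, ← Measure.map_map (by fun_prop) (by fun_prop), h0,
      Measure.map_map (by fun_prop) (by fun_prop)]
    exact Measure.map_id
  · rw [hstep t]
    simp only [κ, Q, hmarg t]

theorem exists_inducedLaw (hπ : S.IsDetStationary π) {γ : S.Adversary} (hγ : S.IsAdversary γ)
    (x : S.X) : ∃ P, S.IsInducedLaw π γ x P := by
  choose ver hver hae using fun t (Q : Measure (S.HistE (t + 1))) =>
    exists_kernel_ae_eq (hγ (t + 1)).1 (fun h => ((hγ (t + 1)).2 h).1) Q
  -- The initial history is deterministic, so `γ 0` is used at this single point and needs no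
  -- measurable version.
  let h₀ : S.HistE 0 := (fun i => i.elim0, x, π x)
  have hg₀ : Measurable fun μ : ProbabilityMeasure S.W => ((x, π x, μ) : S.Stage) := by fun_prop
  have hγ₀ := ((hγ 0).2 h₀).1
  let μ₀ : Measure S.Stage := (γ 0 h₀).map fun μ => (x, π x, μ)
  have hμ₀ : IsProbabilityMeasure μ₀ := Measure.isProbabilityMeasure_map hg₀.aemeasurable
  obtain ⟨P, hP, hP0, hstep⟩ := exists_trajectory_measure hπ.1 μ₀ ver hver
  let ρ : ∀ t, Measure (S.Upto t) := fun t => P.map (Preorder.frestrictLe t)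
  have hρ : ∀ t, IsProbabilityMeasure (ρ t) := fun t =>
    Measure.isProbabilityMeasure_map (by fun_prop)
  let Q : ∀ t, Measure (S.HistE (t + 1)) := fun t => ((ρ t) ⊗ₘ stateKernel t).map (Upto.hist π)
  have hQ : ∀ t, IsProbabilityMeasure (Q t) := fun t =>
    Measure.isProbabilityMeasure_map (Upto.measurable_hist hπ.1 t).aemeasurable
  -- One-step formula from which the conditions at positive times follow by choice of `F`.
  have hlin : ∀ t (F : S.Upto t × S.Stage → ℝ≥0∞), Measurable F →
      ∫⁻ ω, F (Preorder.frestrictLe t ω, ω (t + 1)) ∂P =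
        ∫⁻ p, ∫⁻ x, ∫⁻ μ, F (p, x, π x, μ) ∂ver t (Q t) (Upto.hist π (p, x))
          ∂S.nextState p.last ∂ρ t := by
    intro t F hF
    have hm : Measurable fun ω : S.Traj => (Preorder.frestrictLe t ω, ω (t + 1)) := by fun_prop
    have := hver t (Q t)
    rw [← lintegral_map (g := fun ω : S.Traj => (Preorder.frestrictLe t ω, ω (t + 1))) hF hm,
      hstep t, Measure.lintegral_compProd hF]
    refine lintegral_congr fun p => ?_
    exact lintegral_stepKernel hπ.1 t _ p (hF.comp (measurable_const.prodMk measurable_id))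
  have hinit : ∀ᵐ ω ∂P, (ω 0).1 = x ∧ (ω 0).2.1 = π x := by
    have hmeas : MeasurableSet {s : S.Stage | s.1 = x ∧ s.2.1 = π x} :=
      (measurableSet_eq_fun measurable_fst measurable_const).inter
        (measurableSet_eq_fun (measurable_fst.comp measurable_snd) measurable_const)
    have h1 : ∀ᵐ s ∂μ₀, s.1 = x ∧ s.2.1 = π x :=
      (ae_map_iff hg₀.aemeasurable hmeas).2 (ae_of_all _ fun μ => ⟨rfl, rfl⟩)
    rw [← hP0] at h1
    exact (ae_map_iff (measurable_pi_apply 0).aemeasurable hmeas).1 h1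
  have hctrl : ∀ t, ∀ᵐ ω ∂P, (ω t).2.1 = π (ω t).1 := by
    intro t
    cases t with
    | zero => filter_upwards [hinit] with ω hω; rw [hω.1, hω.2]
    | succ t =>
      have hmeas : MeasurableSet {s : S.Upto t × S.Stage | s.2.2.1 = π s.2.1}ᶜ :=
        (measurableSet_eq_fun (by fun_prop) (hπ.1.comp (by fun_prop))).compl
      have hm : Measurable fun ω : S.Traj => (Preorder.frestrictLe t ω, ω (t + 1)) := by fun_prop
      have h : ∫⁻ ω, (indicator {s : S.Upto t × S.Stage | s.2.2.1 = π s.2.1}ᶜ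
          (1 : S.Upto t × S.Stage → ℝ≥0∞) ∘ fun ω : S.Traj => (Preorder.frestrictLe t ω, ω (t + 1))) ω ∂P = 0 :=
        (hlin t _ (measurable_one.indicator hmeas)).trans (by simp [indicator])
      have h' := (lintegral_eq_zero_iff ((measurable_one.indicator hmeas).comp hm)).1 h
      filter_upwards [h'] with ω hω
      by_contra hne
      simp [indicator, hne] at hω
  refine ⟨P, hP, hinit.mono fun ω h => h.1, hctrl, ?_, ?_⟩
  · intro t A hA B hB
    cases t with
    | zero =>
      have hh : ∀ᵐ ω ∂P, S.histE 0 ω = h₀ := by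
        filter_upwards [hinit] with ω hω
        exact Prod.ext (Subsingleton.elim _ _) (Prod.ext hω.1 hω.2)
      have hB' : P {ω | (ω 0).2.2 ∈ B} = γ 0 h₀ B := by
        have hBm : MeasurableSet {s : S.Stage | s.2.2 ∈ B} :=
          (measurable_snd.comp measurable_snd) hB
        have h1 : P {ω | (ω 0).2.2 ∈ B} = μ₀ {s | s.2.2 ∈ B} := by
          rw [← hP0, Measure.map_apply (by fun_prop) hBm]; rfl
        rw [h1, Measure.map_apply hg₀ hBm]; rfl
      have hl : P {ω | S.histE 0 ω ∈ A ∧ (ω 0).2.2 ∈ B} =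
          P {ω | h₀ ∈ A ∧ (ω 0).2.2 ∈ B} := measure_congr (by
        filter_upwards [hh] with ω hω
        simp only [eq_iff_iff]
        change (S.histE 0 ω ∈ A ∧ _) ↔ (h₀ ∈ A ∧ _)
        rw [hω])
      have hr : P.restrict {ω | S.histE 0 ω ∈ A} = P.restrict {_ω | h₀ ∈ A} :=
        Measure.restrict_congr_set (by
          filter_upwards [hh] with ω hω
          simp only [eq_iff_iff]
          change S.histE 0 ω ∈ A ↔ h₀ ∈ A
          rw [hω])
      rw [hl, hr, lintegral_congr_ae (g := fun _ => γ 0 h₀ B)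
        (ae_restrict_of_ae (hh.mono fun ω hω => by rw [hω]))]
      by_cases hA0 : h₀ ∈ A <;> simp [hA0, hB']
    | succ t =>
      have hκ := hver t (Q t)
      have hm : Measurable fun ω : S.Traj => (S.histE (t + 1) ω, (ω (t + 1)).2.2) := by
        unfold histE past; fun_prop
      have hmh : Measurable fun ω : S.Traj => S.histE (t + 1) ω := by
        unfold histE past; fun_prop
      have hjoint : P.map (fun ω => (S.histE (t + 1) ω, (ω (t + 1)).2.2)) =
          Q t ⊗ₘ ver t (Q t) := by
        refine Measure.ext_of_lintegral _ fun F hF => ?_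
        have hg : Measurable fun z : S.Upto t × S.Stage =>
            ((z.1.toPast, z.2.1, z.2.2.1), z.2.2.2) :=
          (((Upto.measurable_toPast t).comp measurable_fst).prodMk (by fun_prop)).prodMk
            (by fun_prop)
        have h := hlin t (fun z => F ((z.1.toPast, z.2.1, z.2.2.1), z.2.2.2)) (hF.comp hg)
        have hFm : Measurable fun h => ∫⁻ μ, F (h, μ) ∂ver t (Q t) h :=
          Measurable.lintegral_kernel_prod_right hF
        rw [lintegral_map hF hm, Measure.lintegral_compProd hF,
          lintegral_map hFm (Upto.measurable_hist hπ.1 t)]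
        exact h.trans
          (Measure.lintegral_compProd (μ := ρ t) (κ := stateKernel t)
            (hFm.comp (Upto.measurable_hist hπ.1 t))).symm
      have hhist : P.map (S.histE (t + 1)) = Q t := by
        have := congrArg Measure.fst hjoint
        rw [Measure.fst_compProd, Measure.fst, Measure.map_map measurable_fst hm] at this
        exact this
      have hae' := hae t (Q t) (hQ t)
      have hAB := congrArg (fun ν => ν (A ×ˢ B)) hjoint
      simp only [Measure.map_apply hm (hA.prod hB), Measure.compProd_apply_prod hA hB] at hAB
      rw [← hhist] at hae'
      have hae'' := ae_of_ae_map hmh.aemeasurable hae'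
      rw [lintegral_congr_ae (g := fun ω => ver t (Q t) (S.histE (t + 1) ω) B)
        (ae_restrict_of_ae (hae''.mono fun ω hω => by simp only; rw [← hhist, hω]))]
      refine Eq.trans hAB ?_
      exact (congrArg (fun ν => ∫⁻ h in A, ver t (Q t) h B ∂ν) hhist).symm.trans
        (setLIntegral_map hA (Kernel.measurable_coe _ hB) hmh)
  · intro t A hA B hB
    have hκ := hver t (Q t)
    let D : Set (S.Upto t × S.Stage) := {z | z.1.toPast ∈ A ∧ z.2.1 ∈ B}
    have hD : MeasurableSet D :=
      ((Upto.measurable_toPast t).comp measurable_fst hA).inter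
        ((measurable_fst.comp measurable_snd) hB)
    have hm : Measurable fun ω : S.Traj => (Preorder.frestrictLe t ω, ω (t + 1)) := by fun_prop
    have hmr : Measurable fun ω : S.Traj => (Preorder.frestrictLe t ω : S.Upto t) := by fun_prop
    have h := hlin t (indicator D 1) (measurable_one.indicator hD)
    have hl : ∫⁻ ω, indicator D 1 (Preorder.frestrictLe t ω, ω (t + 1)) ∂P =
        P {ω | S.past (t + 1) ω ∈ A ∧ (ω (t + 1)).1 ∈ B} := by
      exact lintegral_indicator_one (hm hD)
    rw [← hl, h]
    have hin : ∀ p : S.Upto t, ∫⁻ x, ∫⁻ μ, indicator D 1 (p, x, π x, μ)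
        ∂ver t (Q t) (Upto.hist π (p, x)) ∂S.nextState p.last =
        indicator {p | p.toPast ∈ A} (fun p => S.nextState p.last B) p := by
      intro p
      by_cases hp : p.toPast ∈ A
      · rw [indicator_of_mem (by exact hp), ← lintegral_indicator_one hB]
        refine lintegral_congr fun x => ?_
        by_cases hx : x ∈ B <;> simp [D, indicator, hp, hx]
      · rw [indicator_of_notMem (by exact hp)]
        simp [D, indicator, hp]
    have hAm : MeasurableSet {p : S.Upto t | p.toPast ∈ A} := Upto.measurable_toPast t hA
    have hnm : Measurable fun p : S.Upto t => S.nextState p.last B :=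
      (Kernel.measurable_coe _ hB).comp (Upto.measurable_last t)
    simp only [hin]
    rw [lintegral_indicator hAm, setLIntegral_map hAm hnm hmr]
    refine lintegral_congr fun ω => ?_
    exact S.nextState_apply _ hB

end DRSystem

theorem MeasureTheory.Integrable.integral_comp_measure {α β : Type*} [MeasurableSpace α]
    [MeasurableSpace β] {κ : Kernel α β} {μ : Measure α} {f : β → ℝ}
    (hf : Integrable f (κ ∘ₘ μ)) :
    Integrable (fun a => ∫ y, f y ∂κ a) μ ∧
      ∫ a, ∫ y, f y ∂κ a ∂μ = ∫ y, f y ∂(κ ∘ₘ μ) := by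
  rw [Measure.comp_eq_comp_const_apply] at hf ⊢
  exact ⟨hf.integral_comp, (Kernel.integral_comp hf).symm⟩

namespace DRSystem

variable {n m l N : ℕ} {S : DRSystem n m l N} {π : S.X → S.U} {γ : S.Adversary} {x : S.X}
  {P : Measure S.Traj} {ξ : S.X → ℝ} {b β : ℝ}

/-! ### One-step properties of an induced law -/

theorem measurable_histE (t : ℕ) : Measurable (S.histE t) := by
  unfold histE past
  fun_prop

theorem measurable_state (t : ℕ) : Measurable fun ω : S.Traj => (ω t).1 :=
  measurable_fst.comp (measurable_pi_apply t)

theorem measurable_stage (t : ℕ) : Measurable fun ω : S.Traj => ω t := measurable_pi_apply t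

theorem IsInducedLaw.exists_kernel (hγ : S.IsAdversary γ) (hP : S.IsInducedLaw π γ x P) (t : ℕ) :
    ∃ κ : Kernel (S.HistE t) (ProbabilityMeasure S.W), IsMarkovKernel κ ∧
      (∀ᵐ h ∂P.map (S.histE t), κ h = γ t h) ∧
      P.map (fun ω => (S.histE t ω, (ω t).2.2)) = P.map (S.histE t) ⊗ₘ κ := by
  have := hP.isProbabilityMeasure
  have hh := measurable_histE (S := S) t
  have hm : Measurable fun ω : S.Traj => (S.histE t ω, (ω t).2.2) := hh.prodMk (by fun_prop)
  have hQ : IsProbabilityMeasure (P.map (S.histE t)) :=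
    Measure.isProbabilityMeasure_map hh.aemeasurable
  obtain ⟨κ, hκ, hae⟩ := exists_kernel_ae_eq (hγ t).1 (fun h => ((hγ t).2 h).1)
    (P.map (S.histE t))
  refine ⟨κ, hκ, hae hQ, ?_⟩
  have : IsProbabilityMeasure (P.map fun ω : S.Traj => (S.histE t ω, (ω t).2.2)) :=
    Measure.isProbabilityMeasure_map hm.aemeasurable
  refine Measure.ext_prod fun {A B} hA hB => ?_
  rw [Measure.map_apply hm (hA.prod hB), Measure.compProd_apply_prod hA hB,
    setLIntegral_map hA (Kernel.measurable_coe _ hB) hh]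
  refine (hP.adversary t A hA B hB).trans (lintegral_congr_ae (ae_restrict_of_ae ?_))
  filter_upwards [ae_of_ae_map hh.aemeasurable (hae hQ)] with ω hω
  rw [hω]

/-- Both directions are needed: one carries properties of `γ` to trajectories, the other carries
null sets of trajectories back to `γ`. -/
theorem IsInducedLaw.ae_histE_iff (hγ : S.IsAdversary γ) (hP : S.IsInducedLaw π γ x P) (t : ℕ)
    {R : S.HistE t × ProbabilityMeasure S.W → Prop} (hR : MeasurableSet {z | R z}) :
    (∀ᵐ ω ∂P, R (S.histE t ω, (ω t).2.2)) ↔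
      ∀ᵐ h ∂P.map (S.histE t), ∀ᵐ μ ∂γ t h, R (h, μ) := by
  have := hP.isProbabilityMeasure
  have hh := measurable_histE (S := S) t
  have hm : Measurable fun ω : S.Traj => (S.histE t ω, (ω t).2.2) := hh.prodMk (by fun_prop)
  obtain ⟨κ, hκ, hae, hjoint⟩ := hP.exists_kernel hγ t
  have h1 := ae_map_iff (μ := P) hm.aemeasurable hR
  rw [hjoint] at h1
  rw [← h1, Measure.ae_compProd_iff hR]
  refine eventually_congr (hae.mono fun h hh => ?_)
  rw [hh]

theorem IsInducedLaw.map_state_succ (hP : S.IsInducedLaw π γ x P) (t : ℕ) :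
    P.map (fun ω => (ω (t + 1)).1) = S.nextState ∘ₘ P.map (fun ω => ω t) := by
  ext B hB
  have h := hP.transition t univ MeasurableSet.univ B hB
  simp only [mem_univ, true_and, ofPred_true, Measure.restrict_univ] at h
  rw [Measure.map_apply (measurable_state _) hB, Measure.bind_apply hB S.nextState.aemeasurable,
    lintegral_map (Kernel.measurable_coe _ hB) (measurable_stage t)]
  exact h.trans (lintegral_congr fun ω => (S.nextState_apply _ hB).symm)

theorem IsInducedLaw.ae_stage_eq (hP : S.IsInducedLaw π γ x P) (t : ℕ) :
    ∀ᵐ ω ∂P, ω t = ((ω t).1, π (ω t).1, (ω t).2.2) := by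
  filter_upwards [hP.control t] with ω hω
  exact Prod.ext rfl (Prod.ext hω rfl)

theorem measurable_mkStage_histE (hπ : S.IsDetStationary π) (t : ℕ) :
    Measurable fun z : S.HistE t × ProbabilityMeasure S.W =>
      ((z.1.2.1, π z.1.2.1, z.2) : S.Stage) := by
  have h1 : Measurable fun z : S.HistE t × ProbabilityMeasure S.W => z.1.2.1 := by fun_prop
  exact h1.prodMk ((hπ.1.comp h1).prodMk measurable_snd)

/-! ### Growth of the weight function -/

theorem lintegral_weight_nextState_le (hS : S.SemicontinuousModel ξ b β)
    (hπ : S.IsDetStationary π) (x : S.X) {μ : ProbabilityMeasure S.W} (hμ : μ ∈ S.ball) :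
    ∫⁻ y, ENNReal.ofReal (ξ y) ∂S.nextState (x, π x, μ) ≤ ENNReal.ofReal (β * ξ x) := by
  rw [S.nextState_eq_map, lintegral_map (hS.continuous_weight.measurable.ennreal_ofReal)
    (S.measurable_f_stage _)]
  have hi := hS.integrable_weight μ hμ (x, π x) (hπ.2 x)
  refine le_trans (le_of_eq ?_) (ENNReal.ofReal_le_ofReal (hS.weight_le μ hμ (x, π x) (hπ.2 x)))
  exact (ofReal_integral_eq_lintegral_ofReal hi
    (ae_of_all _ fun w => zero_le_one.trans (hS.one_le_weight _))).symm

theorem IsInducedLaw.lintegral_weight_le (hS : S.SemicontinuousModel ξ b β)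
    (hπ : S.IsDetStationary π) (hγ : S.IsAdversary γ) (hP : S.IsInducedLaw π γ x P) (t : ℕ) :
    ∫⁻ ω, ENNReal.ofReal (ξ (ω t).1) ∂P ≤ ENNReal.ofReal (β ^ t * ξ x) := by
  have := hP.isProbabilityMeasure
  have hξ : Measurable fun y => ENNReal.ofReal (ξ y) :=
    hS.continuous_weight.measurable.ennreal_ofReal
  have hβ : 0 ≤ β := zero_le_one.trans hS.one_le_β
  induction t with
  | zero =>
    rw [lintegral_congr_ae (g := fun _ => ENNReal.ofReal (ξ x))
      (hP.initial.mono fun ω hω => by simp only [hω])]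
    simp
  | succ t ih =>
    have hstep : ∀ᵐ ω ∂P, ∫⁻ y, ENNReal.ofReal (ξ y) ∂S.nextState (ω t) ≤
        ENNReal.ofReal (β * ξ (ω t).1) := by
      -- The measurable weight inequality is transferred instead of membership in the ball, whose
      -- measurability is not established.
      have hR : MeasurableSet {z : S.HistE t × ProbabilityMeasure S.W |
          ∫⁻ y, ENNReal.ofReal (ξ y) ∂S.nextState (z.1.2.1, π z.1.2.1, z.2) ≤
            ENNReal.ofReal (β * ξ z.1.2.1)} := by
        refine measurableSet_le (hξ.lintegral_kernel.comp (measurable_mkStage_histE hπ t)) ?_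
        exact (measurable_const.mul
          (hS.continuous_weight.measurable.comp (by fun_prop))).ennreal_ofReal
      have h := (hP.ae_histE_iff hγ t hR).2 (ae_of_all _ fun h =>
        ((hγ t).2 h).2.mono fun μ hμ => lintegral_weight_nextState_le hS hπ h.2.1 hμ)
      filter_upwards [h, hP.ae_stage_eq t] with ω hω hs
      rw [hs]
      exact hω
    calc ∫⁻ ω, ENNReal.ofReal (ξ (ω (t + 1)).1) ∂P
        = ∫⁻ ω, ∫⁻ y, ENNReal.ofReal (ξ y) ∂S.nextState (ω t) ∂P := by
          rw [← lintegral_map (f := fun y => ENNReal.ofReal (ξ y)) hξ (measurable_state (t + 1)),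
            hP.map_state_succ,
            Measure.lintegral_bind S.nextState.aemeasurable hξ.aemeasurable,
            lintegral_map hξ.lintegral_kernel (measurable_stage t)]
      _ ≤ ∫⁻ ω, ENNReal.ofReal β * ENNReal.ofReal (ξ (ω t).1) ∂P :=
          lintegral_mono_ae (hstep.mono fun ω hω => hω.trans_eq (ENNReal.ofReal_mul hβ))
      _ = ENNReal.ofReal β * ∫⁻ ω, ENNReal.ofReal (ξ (ω t).1) ∂P :=
          lintegral_const_mul _ (hξ.comp (measurable_state t))
      _ ≤ ENNReal.ofReal β * ENNReal.ofReal (β ^ t * ξ x) := by gcongr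
      _ = ENNReal.ofReal (β ^ (t + 1) * ξ x) := by
          rw [← ENNReal.ofReal_mul hβ]
          congr 1
          ring

theorem IsInducedLaw.integrable_weight (hS : S.SemicontinuousModel ξ b β)
    (hπ : S.IsDetStationary π) (hγ : S.IsAdversary γ) (hP : S.IsInducedLaw π γ x P) (t : ℕ) :
    Integrable (fun ω => ξ (ω t).1) P := by
  refine ⟨(hS.continuous_weight.measurable.comp (measurable_state t)).aestronglyMeasurable, ?_⟩
  rw [hasFiniteIntegral_iff_ofReal (ae_of_all _ fun ω =>
    zero_le_one.trans (hS.one_le_weight _))]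
  exact (hP.lintegral_weight_le hS hπ hγ t).trans_lt ENNReal.ofReal_lt_top

theorem IsInducedLaw.integral_weight_le (hS : S.SemicontinuousModel ξ b β)
    (hπ : S.IsDetStationary π) (hγ : S.IsAdversary γ) (hP : S.IsInducedLaw π γ x P) (t : ℕ) :
    ∫ ω, ξ (ω t).1 ∂P ≤ β ^ t * ξ x := by
  have h0 : 0 ≤ β ^ t * ξ x := mul_nonneg (pow_nonneg (zero_le_one.trans hS.one_le_β) _)
    (zero_le_one.trans (hS.one_le_weight _))
  rw [integral_eq_lintegral_of_nonneg_ae (ae_of_all _ fun ω =>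
    zero_le_one.trans (hS.one_le_weight _)) (hP.integrable_weight hS hπ hγ t).1]
  exact ENNReal.toReal_le_of_le_ofReal h0 (hP.lintegral_weight_le hS hπ hγ t)

theorem IsInducedLaw.integrable_value (hS : S.SemicontinuousModel ξ b β)
    (hπ : S.IsDetStationary π) (hγ : S.IsAdversary γ) (hP : S.IsInducedLaw π γ x P)
    {v : S.X → ℝ} {C : ℝ} (hv : UniversallyMeasurable v) (hC : ∀ y, |v y| ≤ C * ξ y) (t : ℕ) :
    Integrable (fun ω => v (ω t).1) P := by
  have := hP.isProbabilityMeasure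
  exact ((hP.integrable_weight hS hπ hγ t).const_mul C).mono'
    ((hv.comp_measurable (measurable_state t)).aestronglyMeasurable P)
    (ae_of_all _ fun ω => hC _)

theorem IsInducedLaw.abs_integral_value_le (hS : S.SemicontinuousModel ξ b β)
    (hπ : S.IsDetStationary π) (hγ : S.IsAdversary γ) (hP : S.IsInducedLaw π γ x P)
    {v : S.X → ℝ} {C : ℝ} (hC : ∀ y, |v y| ≤ C * ξ y) (hC0 : 0 ≤ C) (t : ℕ) :
    |∫ ω, v (ω t).1 ∂P| ≤ C * (β ^ t * ξ x) := by
  calc |∫ ω, v (ω t).1 ∂P| ≤ ∫ ω, C * ξ (ω t).1 ∂P :=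
        norm_integral_le_of_norm_le (f := fun ω => v (ω t).1)
          ((hP.integrable_weight hS hπ hγ t).const_mul C) (ae_of_all _ fun ω => hC _)
    _ = C * ∫ ω, ξ (ω t).1 ∂P := integral_const_mul _ _
    _ ≤ C * (β ^ t * ξ x) := by
        gcongr
        exact hP.integral_weight_le hS hπ hγ t

/-! ### The one-step gap -/

/-- As `v` is only universally measurable, the gap is replaced by one built from Borel versions of
`v` for the laws of `x_t` and `x_{t+1}`. The set `I` serves both verification bounds: `Ici 0` for
the upper one, `Iic ε` for the lower one. -/
theorem IsInducedLaw.exists_gap (hS : S.SemicontinuousModel ξ b β)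
    (hπ : S.IsDetStationary π) (hγ : S.IsAdversary γ) (hP : S.IsInducedLaw π γ x P)
    {v : S.X → ℝ} {C : ℝ} (hv : UniversallyMeasurable v) (hC : ∀ y, |v y| ≤ C * ξ y) (t : ℕ)
    {I : Set ℝ} (hI : MeasurableSet I)
    (hgap : ∀ h : S.HistE t, ∀ᵐ μ ∂γ t h, v h.2.1 - S.stageValue π v h.2.1 μ ∈ I) :
    ∃ Y : S.Traj → ℝ, Integrable Y P ∧ (∀ᵐ ω ∂P, Y ω ∈ I) ∧
      ∫ ω, Y ω ∂P = ∫ ω, v (ω t).1 ∂P - ∫ ω, S.c (ω t).1 (π (ω t).1) ∂P -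
        S.α * ∫ ω, v (ω (t + 1)).1 ∂P := by
  have := hP.isProbabilityMeasure
  have hν (s : ℕ) : IsProbabilityMeasure (P.map fun ω : S.Traj => (ω s).1) :=
    Measure.isProbabilityMeasure_map (measurable_state s).aemeasurable
  have hversion (s : ℕ) : ∃ v' : S.X → ℝ, Measurable v' ∧ ∃ Z : Set S.X, MeasurableSet Z ∧
      (P.map fun ω : S.Traj => (ω s).1) Z = 0 ∧ ∀ y ∉ Z, v y = v' y := by
    have hm := hv.aestronglyMeasurable (P.map fun ω : S.Traj => (ω s).1)
    obtain ⟨Z, hsub, hZ, hZ0⟩ := exists_measurable_superset_of_null hm.ae_eq_mk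
    exact ⟨hm.mk v, hm.stronglyMeasurable_mk.measurable, Z, hZ, hZ0, fun y hy =>
      by_contra fun hne => hy (hsub hne)⟩
  obtain ⟨v₁, hv₁, Z₁, hZ₁, hZ₁0, he₁⟩ := hversion t
  obtain ⟨v₂, hv₂, Z₂, hZ₂, hZ₂0, he₂⟩ := hversion (t + 1)
  let st : S.HistE t × ProbabilityMeasure S.W → S.Stage := fun z => (z.1.2.1, π z.1.2.1, z.2)
  have hst : Measurable st := measurable_mkStage_histE hπ t
  let gap : S.HistE t × ProbabilityMeasure S.W → ℝ := fun z =>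
    v₁ z.1.2.1 - S.c z.1.2.1 (π z.1.2.1) - S.α * ∫ y, v₂ y ∂S.nextState (st z)
  have hx : Measurable fun z : S.HistE t × ProbabilityMeasure S.W => z.1.2.1 := by fun_prop
  have hint : Measurable fun s => ∫ y, v₂ y ∂S.nextState s :=
    hv₂.stronglyMeasurable.integral_kernel.measurable
  have hgapm : Measurable gap :=
    ((hv₁.comp hx).sub ((measurable_stageCost hS hπ).comp hx)).sub
      (measurable_const.mul (hint.comp hst))
  have hG : MeasurableSet {z : S.HistE t × ProbabilityMeasure S.W |
      z.1.2.1 ∉ Z₁ ∧ S.nextState (st z) Z₂ = 0} :=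
    (hx hZ₁).compl.inter (((Kernel.measurable_coe _ hZ₂).comp hst) (measurableSet_singleton 0))
  have hω₁ : ∀ᵐ ω ∂P, (ω t).1 ∉ Z₁ := by
    rw [Measure.map_apply (measurable_state t) hZ₁] at hZ₁0
    exact measure_eq_zero_iff_ae_notMem.1 hZ₁0
  have hω₃ : ∀ᵐ ω ∂P, (ω (t + 1)).1 ∉ Z₂ := by
    rw [Measure.map_apply (measurable_state (t + 1)) hZ₂] at hZ₂0
    exact measure_eq_zero_iff_ae_notMem.1 hZ₂0
  -- The law of `x_{t+1}` is a mixture of the transition laws, so almost all of them ignore its null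
  -- set `Z₂`.
  have hω₂ : ∀ᵐ ω ∂P, S.nextState (ω t) Z₂ = 0 := by
    rw [hP.map_state_succ, Measure.bind_apply hZ₂ S.nextState.aemeasurable,
      lintegral_map (Kernel.measurable_coe _ hZ₂) (measurable_stage t)] at hZ₂0
    exact (lintegral_eq_zero_iff ((Kernel.measurable_coe _ hZ₂).comp (measurable_stage t))).1 hZ₂0
  have hGω : ∀ᵐ ω ∂P, (S.histE t ω).2.1 ∉ Z₁ ∧
      S.nextState (st (S.histE t ω, (ω t).2.2)) Z₂ = 0 := by
    filter_upwards [hω₁, hω₂, hP.ae_stage_eq t] with ω h1 h2 h3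
    exact ⟨h1, by rw [h3] at h2; exact h2⟩
  have heq : ∀ z : S.HistE t × ProbabilityMeasure S.W, z.1.2.1 ∉ Z₁ →
      S.nextState (st z) Z₂ = 0 → v z.1.2.1 - S.stageValue π v z.1.2.1 z.2 = gap z := by
    intro z h1 h2
    have h3 : ∫ w, v (S.f z.1.2.1 (π z.1.2.1) w) ∂(z.2 : Measure S.W) =
        ∫ y, v₂ y ∂S.nextState (st z) := by
      rw [S.nextState_eq_map, integral_map (S.measurable_f_stage _).aemeasurable
        hv₂.aestronglyMeasurable]
      rw [S.nextState_apply _ hZ₂] at h2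
      refine integral_congr_ae ?_
      have : ∀ᵐ w ∂(z.2 : Measure S.W), S.f z.1.2.1 (π z.1.2.1) w ∉ Z₂ := by
        simpa [ae_iff] using h2
      exact this.mono fun w hw => he₂ _ hw
    simp only [stageValue, gap, h3, he₁ _ h1]
    ring
  refine ⟨fun ω => gap (S.histE t ω, (ω t).2.2), ?_⟩
  have hYI : ∀ᵐ ω ∂P, gap (S.histE t ω, (ω t).2.2) ∈ I := by
    refine (hP.ae_histE_iff hγ t (R := fun z => gap z ∈ I) (hgapm hI)).2 ?_
    filter_upwards [(hP.ae_histE_iff hγ t hG).1 hGω] with h hh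
    filter_upwards [hh, hgap h] with μ h1 h2
    rw [← heq (h, μ) h1.1 h1.2]
    exact h2
  have hcost : Integrable (fun ω => S.c (ω t).1 (π (ω t).1)) P :=
    hP.integrable_value hS hπ hγ (measurable_stageCost hS hπ).universallyMeasurable
      (abs_stageCost_le hS hπ) t
  have hnext : Integrable v₂ (S.nextState ∘ₘ P.map (fun ω => ω t)) := by
    rw [← hP.map_state_succ, integrable_map_measure hv₂.aestronglyMeasurable
      (measurable_state _).aemeasurable]
    exact (hP.integrable_value hS hπ hγ hv hC (t + 1)).congr (hω₃.mono fun ω hω => he₂ _ hω)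
  have hnexti := hnext.integral_comp_measure
  rw [integrable_map_measure hint.aestronglyMeasurable (measurable_stage t).aemeasurable,
    integral_map (measurable_stage t).aemeasurable hint.aestronglyMeasurable,
    ← hP.map_state_succ,
    integral_map (measurable_state _).aemeasurable hv₂.aestronglyMeasurable] at hnexti
  have hnextv : ∫ ω, v₂ (ω (t + 1)).1 ∂P = ∫ ω, v (ω (t + 1)).1 ∂P := 
    integral_congr_ae (hω₃.mono fun ω hω => (he₂ _ hω).symm)
  have hYeq : (fun ω => gap (S.histE t ω, (ω t).2.2)) =ᵐ[P]
      fun ω => v (ω t).1 - S.c (ω t).1 (π (ω t).1) - S.α * ∫ y, v₂ y ∂S.nextState (ω t) := by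
    filter_upwards [hω₁, hP.ae_stage_eq t] with ω h1 h3
    rw [h3, he₁ _ h1]
    rfl
  have hvi := hP.integrable_value hS hπ hγ hv hC t
  have hα : Integrable (fun ω => S.α * ∫ y, v₂ y ∂S.nextState (ω t)) P :=
    hnexti.1.const_mul S.α
  have hvc : Integrable (fun ω => v (ω t).1 - S.c (ω t).1 (π (ω t).1)) P := hvi.sub hcost
  refine ⟨(hvc.sub hα).congr hYeq.symm, hYI, ?_⟩
  rw [integral_congr_ae hYeq, integral_sub hvc hα, integral_sub hvi hcost,
    integral_const_mul]
  congr 2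
  rw [← hnextv]
  exact hnexti.2

/-! ### Comparison of the discounted cost with a value function -/

variable (P) in
/-- The discounted cost of a law of the trajectory. -/
def cost : ℝ := ∫ ω, ∑' t : ℕ, S.α ^ t * S.c (ω t).1 (ω t).2.1 ∂P

theorem IsInducedLaw.hasSum_cost (hS : S.SemicontinuousModel ξ b β)
    (hπ : S.IsDetStationary π) (hγ : S.IsAdversary γ) (hP : S.IsInducedLaw π γ x P) :
    HasSum (fun t => S.α ^ t * ∫ ω, S.c (ω t).1 (π (ω t).1) ∂P) (cost P) := by
  have hc (t : ℕ) : Integrable (fun ω => S.α ^ t * S.c (ω t).1 (π (ω t).1)) P :=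
    (hP.integrable_value hS hπ hγ (measurable_stageCost hS hπ).universallyMeasurable
      (abs_stageCost_le hS hπ) t).const_mul _
  have hle (t : ℕ) : ∫ ω, ‖S.α ^ t * S.c (ω t).1 (π (ω t).1)‖ ∂P ≤
      b * ξ x * (S.α * β) ^ t := by
    have h1 : ∀ y : S.X, |(fun y => |S.c y (π y)|) y| ≤ b * ξ y := fun y => by
      rw [abs_abs]
      exact abs_stageCost_le hS hπ y
    have h2 := (le_abs_self _).trans (hP.abs_integral_value_le hS hπ hγ h1 hS.b_nonneg t)
    simp only [norm_mul, norm_pow, Real.norm_of_nonneg S.α_pos.le, Real.norm_eq_abs,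
      integral_const_mul]
    calc S.α ^ t * ∫ ω, |S.c (ω t).1 (π (ω t).1)| ∂P ≤ S.α ^ t * (b * (β ^ t * ξ x)) := by
          have := S.α_pos
          gcongr
      _ = b * ξ x * (S.α * β) ^ t := by ring
  have hsum : Summable fun t => ∫ ω, ‖S.α ^ t * S.c (ω t).1 (π (ω t).1)‖ ∂P :=
    Summable.of_nonneg_of_le (fun t => integral_nonneg fun ω => norm_nonneg _) hle
      ((summable_geometric_of_lt_one (discount_mul_nonneg hS) (discount_mul_lt_one hS)).mul_left _)
  have h := hasSum_integral_of_summable_integral_norm hc hsum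
  simp only [integral_const_mul] at h
  have heq : cost P = ∫ ω, ∑' t : ℕ, S.α ^ t * S.c (ω t).1 (π (ω t).1) ∂P := by
    refine integral_congr_ae ?_
    filter_upwards [ae_all_iff.2 hP.control] with ω hω
    simp only [hω]
  rwa [heq]

theorem IsInducedLaw.integral_initial (hP : S.IsInducedLaw π γ x P) (v : S.X → ℝ) :
    ∫ ω, v (ω 0).1 ∂P = v x := by
  have := hP.isProbabilityMeasure
  rw [integral_congr_ae (g := fun _ => v x) (hP.initial.mono fun ω hω => by simp only [hω])]
  simp

/-- The value terms telescope, and the remainder `α^T E[v(x_T)]` is at most `C ξ(x) (α β)^T` in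
absolute value. -/
theorem IsInducedLaw.tendsto_sum_gap (hS : S.SemicontinuousModel ξ b β)
    (hπ : S.IsDetStationary π) (hγ : S.IsAdversary γ) (hP : S.IsInducedLaw π γ x P)
    {v : S.X → ℝ} {C : ℝ} (hC : ∀ y, |v y| ≤ C * ξ y) (hC0 : 0 ≤ C) :
    Tendsto (fun T => ∑ t ∈ Finset.range T, S.α ^ t * (∫ ω, v (ω t).1 ∂P -
      ∫ ω, S.c (ω t).1 (π (ω t).1) ∂P - S.α * ∫ ω, v (ω (t + 1)).1 ∂P)) atTop
      (𝓝 (v x - cost P)) := by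
  have htel (T : ℕ) : ∑ t ∈ Finset.range T, S.α ^ t * (∫ ω, v (ω t).1 ∂P -
      ∫ ω, S.c (ω t).1 (π (ω t).1) ∂P - S.α * ∫ ω, v (ω (t + 1)).1 ∂P) =
      v x - S.α ^ T * ∫ ω, v (ω T).1 ∂P -
        ∑ t ∈ Finset.range T, S.α ^ t * ∫ ω, S.c (ω t).1 (π (ω t).1) ∂P := by
    induction T with
    | zero => simp [hP.integral_initial]
    | succ T ih =>
      rw [Finset.sum_range_succ, ih, Finset.sum_range_succ]
      ring
  have htail : Tendsto (fun T => S.α ^ T * ∫ ω, v (ω T).1 ∂P) atTop (𝓝 0) := by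
    have hgeo : Tendsto (fun T : ℕ => C * ξ x * (S.α * β) ^ T) atTop (𝓝 0) := by
      simpa using (tendsto_pow_atTop_nhds_zero_of_lt_one (discount_mul_nonneg hS)
        (discount_mul_lt_one hS)).const_mul (C * ξ x)
    refine squeeze_zero_norm (fun T => ?_) hgeo
    rw [norm_mul, norm_pow, Real.norm_of_nonneg S.α_pos.le, Real.norm_eq_abs]
    calc S.α ^ T * |∫ ω, v (ω T).1 ∂P| ≤ S.α ^ T * (C * (β ^ T * ξ x)) := by
          have := S.α_pos
          gcongr
          exact hP.abs_integral_value_le hS hπ hγ hC hC0 T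
      _ = C * ξ x * (S.α * β) ^ T := by ring
  simp only [htel]
  simpa using (htail.const_sub (v x)).sub (hP.hasSum_cost hS hπ hγ).tendsto_sum_nat

theorem IsInducedLaw.cost_le (hS : S.SemicontinuousModel ξ b β)
    (hπ : S.IsDetStationary π) (hγ : S.IsAdversary γ) (hP : S.IsInducedLaw π γ x P)
    {v : S.X → ℝ} {C : ℝ} (hv : UniversallyMeasurable v) (hC : ∀ y, |v y| ≤ C * ξ y)
    (hC0 : 0 ≤ C) (hle : ∀ y, ∀ μ ∈ S.ball, S.stageValue π v y μ ≤ v y) :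
    cost P ≤ v x := by
  refine sub_nonneg.1 (ge_of_tendsto' (hP.tendsto_sum_gap hS hπ hγ hC hC0) fun T =>
    Finset.sum_nonneg fun t _ => mul_nonneg (pow_nonneg S.α_pos.le t) ?_)
  obtain ⟨Y, -, hY, hint⟩ := hP.exists_gap hS hπ hγ hv hC t measurableSet_Ici (I := Ici 0)
    fun h => ((hγ t).2 h).2.mono fun μ hμ => sub_nonneg.2 (hle _ μ hμ)
  rw [← hint]
  exact integral_nonneg_of_ae hY

theorem IsInducedLaw.le_cost (hS : S.SemicontinuousModel ξ b β)
    (hπ : S.IsDetStationary π) (hγ : S.IsAdversary γ) (hP : S.IsInducedLaw π γ x P)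
    {v : S.X → ℝ} {C : ℝ} (hv : UniversallyMeasurable v) (hC : ∀ y, |v y| ≤ C * ξ y)
    (hC0 : 0 ≤ C) {ε : ℝ} (hε : 0 ≤ ε)
    (hle : ∀ t h, ∀ᵐ μ ∂γ t h, v h.2.1 - ε ≤ S.stageValue π v h.2.1 μ) :
    v x - ε / (1 - S.α) ≤ cost P := by
  have := hP.isProbabilityMeasure
  refine sub_le_comm.1 (le_of_tendsto' (hP.tendsto_sum_gap hS hπ hγ hC hC0) fun T => ?_)
  calc _ ≤ ∑ t ∈ Finset.range T, S.α ^ t * ε := by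
        refine Finset.sum_le_sum fun t _ => mul_le_mul_of_nonneg_left ?_ (pow_nonneg S.α_pos.le t)
        obtain ⟨Y, hYi, hY, hint⟩ := hP.exists_gap hS hπ hγ hv hC t measurableSet_Iic (I := Iic ε)
          fun h => (hle t h).mono fun μ hμ => sub_le_comm.1 hμ
        rw [← hint]
        simpa using integral_mono_ae hYi (integrable_const ε) hY
    _ = ε * ∑ t ∈ Finset.range T, S.α ^ t := by
        rw [Finset.mul_sum]
        exact Finset.sum_congr rfl fun t _ => mul_comm _ _
    _ ≤ ε * (1 - S.α)⁻¹ := by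
        gcongr
        rw [← tsum_geometric_of_lt_one S.α_pos.le S.α_lt_one]
        exact (summable_geometric_of_lt_one S.α_pos.le S.α_lt_one).sum_le_tsum _
          fun t _ => pow_nonneg S.α_pos.le t
    _ = ε / (1 - S.α) := (div_eq_mul_inv _ _).symm

theorem isInducedLaw_law (hπ : S.IsDetStationary π) (hγ : S.IsAdversary γ) (x : S.X) :
    S.IsInducedLaw π γ x (S.law π γ x) := by
  have h := exists_inducedLaw hπ hγ x
  rw [law, dif_pos h]
  exact h.choose_spec

/-! ### Stationary strategies of Player II -/

theorem isAdversary_stationary {g : S.X → ProbabilityMeasure S.W} (hg : UniversallyMeasurable g)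
    (hball : ∀ x, g x ∈ S.ball) : S.IsAdversary (S.stationary g) := by
  refine fun t => ⟨Measure.measurable_dirac.comp_universallyMeasurable
    (hg.comp_measurable (measurable_fst.comp measurable_snd)), fun h => ⟨?_, ?_⟩⟩
  · exact Measure.dirac.isProbabilityMeasure
  · simp only [stationary, ae_dirac_eq]
    exact hball _

theorem measurable_atomic : Measurable S.atomic := by
  refine Measurable.subtype_mk (Measure.measurable_of_measurable_coe _ fun B hB => ?_)
  have h : ∀ a : S.Atoms, S.atomicMeasure a B = (N : ℝ≥0∞)⁻¹ *
      ∑ i, (ENNReal.ofReal (a.2.2.1 0) * B.indicator 1 (a.1 i) +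
        ENNReal.ofReal (a.2.2.1 1) * B.indicator 1 (a.2.1 i)) := fun a => by
    rw [← lintegral_atomicMeasure, lintegral_indicator_one hB]
  simp only [h]
  have hB1 : Measurable (B.indicator (1 : S.W → ℝ≥0∞)) := measurable_one.indicator hB
  refine (Finset.measurable_sum _ fun i _ => ?_).const_mul _
  exact ((S.measurable_weight 0).ennreal_ofReal.mul (hB1.comp (by fun_prop))).add
    ((S.measurable_weight 1).ennreal_ofReal.mul (hB1.comp (by fun_prop)))

/-! ### The worst-case value -/

theorem treeBound_nonneg (hS : S.SemicontinuousModel ξ b β) : 0 ≤ b / (1 - S.α * β) :=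
  div_nonneg hS.b_nonneg (sub_nonneg.2 (discount_mul_lt_one hS).le)

theorem exists_stageValue_treeSup_le (hS : S.SemicontinuousModel ξ b β)
    (hπ : S.IsDetStationary π) (x : S.X) {μ : ProbabilityMeasure S.W} (hμ : μ ∈ S.ball) :
    ∃ a ∈ S.feasible, S.stageValue π (treeSup π) x μ ≤ S.finiteValue π (treeSup π) x a := by
  refine S.stageValue_le_finiteValue hμ ?_
  have hμp := μ.2
  exact ((hS.integrable_weight μ hμ (x, π x) (hπ.2 x)).const_mul (b / (1 - S.α * β))).mono'
    (((universallyMeasurable_treeSup hS hπ).comp_measurable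
      (S.measurable_f_stage (x, π x, μ))).aestronglyMeasurable (μ : Measure S.W))
    (ae_of_all _ fun w => abs_treeSup_le hS hπ _)

theorem J_le_treeSup (hS : S.SemicontinuousModel ξ b β) (hπ : S.IsDetStationary π)
    (hγ : S.IsAdversary γ) (x : S.X) : S.J π γ x ≤ treeSup π x :=
  (isInducedLaw_law hπ hγ x).cost_le hS hπ hγ (universallyMeasurable_treeSup hS hπ)
    (abs_treeSup_le hS hπ) (treeBound_nonneg hS) fun y μ hμ => by
      obtain ⟨a, ha, h⟩ := exists_stageValue_treeSup_le hS hπ y hμ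
      exact h.trans (finiteValue_le_treeSup hS hπ y ha)

theorem le_J_stationary (hS : S.SemicontinuousModel ξ b β) (hπ : S.IsDetStationary π)
    {a : S.X → S.Atoms} (ha : ∀ x, a x ∈ S.feasible)
    (hum : UniversallyMeasurable fun x => S.atomic (a x)) {ε : ℝ} (hε : 0 ≤ ε)
    (hle : ∀ x, treeSup π x - ε ≤ S.finiteValue π (treeSup π) x (a x)) (x : S.X) :
    treeSup π x - ε / (1 - S.α) ≤ S.J π (S.stationary fun x => S.atomic (a x)) x := by
  have hγ := isAdversary_stationary hum fun x => S.atomic_mem_ball (ha x)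
  refine (isInducedLaw_law hπ hγ x).le_cost hS hπ hγ (universallyMeasurable_treeSup hS hπ)
    (abs_treeSup_le hS hπ) (treeBound_nonneg hS) hε fun t h => ?_
  simp only [stationary, ae_dirac_eq]
  change _ ≤ S.stageValue π (treeSup π) h.2.1 (S.atomic (a h.2.1))
  rw [S.stageValue_atomic]
  exact hle _

theorem exists_universallyMeasurable_atoms (hS : S.SemicontinuousModel ξ b β)
    (hπ : S.IsDetStationary π) (ε : ℝ)
    (hex : ∀ x, ∃ a ∈ S.feasible, treeSup π x - ε ≤ S.finiteValue π (treeSup π) x a) :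
    ∃ a : S.X → S.Atoms, UniversallyMeasurable a ∧ (∀ x, a x ∈ S.feasible) ∧
      ∀ x, treeSup π x - ε ≤ S.finiteValue π (treeSup π) x (a x) := by
  obtain ⟨g, hg, h⟩ := exists_selection hS hπ
  have hpair : UniversallyMeasurable fun x : S.X => (x, treeSup π x - ε) := fun Q hQ =>
    (aemeasurable_id.prodMk ((universallyMeasurable_treeSup hS hπ Q hQ).aemeasurable.sub_const
      ε)).nullMeasurable
  exact ⟨_, hg.comp hpair, fun x => (h x _ (hex x)).1, fun x => (h x _ (hex x)).2⟩

/-- The upper bound is verification with `treeSup`; the lower bound uses stationary selections that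
are `ε`-optimal at each stage. Attainment is not needed. -/
theorem worstValue_eq_treeSup (hS : S.SemicontinuousModel ξ b β) (hπ : S.IsDetStationary π) :
    S.worstValue π = treeSup π := by
  have key : ∀ ε > 0, ∃ γ : {γ : S.Adversary // S.IsAdversary γ}, ∀ x,
      treeSup π x - ε / (1 - S.α) ≤ S.J π γ.1 x := fun ε hε => by
    obtain ⟨a, hum, ha, hle⟩ := exists_universallyMeasurable_atoms hS hπ ε fun x =>
      (exists_lt_finiteValue hS hπ (sub_lt_self _ hε)).imp fun a h => ⟨h.1, h.2.le⟩
    have hum' := measurable_atomic.comp_universallyMeasurable hum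
    exact ⟨⟨_, isAdversary_stationary hum' fun x => S.atomic_mem_ball (ha x)⟩,
      le_J_stationary hS hπ ha hum' hε.le hle⟩
  have hα : 0 < 1 - S.α := sub_pos.2 S.α_lt_one
  have hne : Nonempty {γ : S.Adversary // S.IsAdversary γ} := ⟨(key 1 one_pos).choose⟩
  funext x
  refine le_antisymm (ciSup_le fun γ => J_le_treeSup hS hπ γ.2 x)
    (le_of_forall_pos_le_add fun ε hε => ?_)
  obtain ⟨γ, hγ⟩ := key (ε * (1 - S.α)) (mul_pos hε hα)
  have h1 := hγ x
  rw [mul_div_cancel_right₀ _ hα.ne'] at h1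
  have h2 : S.J π γ.1 x ≤ S.worstValue π x :=
    le_ciSup (f := fun γ : {γ : S.Adversary // S.IsAdversary γ} => S.J π γ.1 x)
      ⟨treeSup π x, forall_mem_range.2 fun γ => J_le_treeSup hS hπ γ.2 x⟩ γ
  linarith

theorem isOptimalAdversary_stationary (hS : S.SemicontinuousModel ξ b β)
    (hπ : S.IsDetStationary π) {a : S.X → S.Atoms} (ha : ∀ x, a x ∈ S.feasible)
    (hum : UniversallyMeasurable fun x => S.atomic (a x))
    (hle : ∀ x, treeSup π x ≤ S.finiteValue π (treeSup π) x (a x)) :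
    S.IsOptimalAdversary π (S.stationary fun x => S.atomic (a x)) := by
  refine ⟨isAdversary_stationary hum fun x => S.atomic_mem_ball (ha x), fun x γ' hγ' => ?_⟩
  have h := le_J_stationary hS hπ ha hum le_rfl (fun x => by simpa using hle x) x
  rw [zero_div, sub_zero] at h
  exact (J_le_treeSup hS hπ hγ' x).trans h

/-- If the supremum over the ambiguity set is attained, so is the worst-case value. -/
theorem exists_treeSup_le_finiteValue (hS : S.SemicontinuousModel ξ b β)
    (hπ : S.IsDetStationary π) {x : S.X} {μ : ProbabilityMeasure S.W}
    (hμ : S.IsWorstDistribution π (treeSup π) x μ) :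
    ∃ a ∈ S.feasible, treeSup π x ≤ S.finiteValue π (treeSup π) x a := by
  obtain ⟨a, ha, hle⟩ := exists_stageValue_treeSup_le hS hπ x hμ.1
  -- Every level below `treeSup x` is exceeded by some feasible point, whose atomic law lies in the
  -- ball and so cannot beat `μ`.
  refine ⟨a, ha, le_trans (le_of_forall_lt fun r hr => ?_) hle⟩
  obtain ⟨a', ha', hr'⟩ := exists_lt_finiteValue hS hπ hr
  rw [← S.stageValue_atomic] at hr'
  exact hr'.trans_le (hμ.2 (S.atomic_mem_ball ha'))

end DRSystem

end

/-! ### The worst-case distribution policy -/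

theorem mainTheorem7 {n m l N : ℕ} (S : DRSystem n m l N) (ξ : S.X → ℝ) (b β : ℝ)
    (hS : S.SemicontinuousModel ξ b β) (π : S.X → S.U) (hπ : S.IsDetStationary π)
    (hatt : ∀ x, ∃ μ, S.IsWorstDistribution π (S.worstValue π) x μ) :
    (∃ a : S.X → S.Atoms, UniversallyMeasurable a ∧
      (∀ x, S.IsFiniteOptimal π (S.worstValue π) x (a x)) ∧
      S.IsOptimalAdversary π (S.stationary fun x => S.atomic (a x))) ∧
    ∀ a : S.X → S.Atoms, (∀ x, S.IsFiniteOptimal π (S.worstValue π) x (a x)) →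
      (∀ x, S.IsWorstDistribution π (S.worstValue π) x (S.atomic (a x))) ∧
      (UniversallyMeasurable (fun x => S.atomic (a x)) →
        S.IsOptimalAdversary π (S.stationary fun x => S.atomic (a x))) := by
  rw [DRSystem.worstValue_eq_treeSup hS hπ] at hatt ⊢
  have hex : ∀ x, ∃ a ∈ S.feasible,
      DRSystem.treeSup π x ≤ S.finiteValue π (DRSystem.treeSup π) x a := fun x =>
    (hatt x).elim fun μ hμ => DRSystem.exists_treeSup_le_finiteValue hS hπ hμ
  refine ⟨?_, fun a ha => ?_⟩
  -- Attainment permits `ε = 0`; as no feasible value exceeds `treeSup x`, the selected points are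
  -- optimal.
  · obtain ⟨a, hum, ha, hle⟩ :=
      DRSystem.exists_universallyMeasurable_atoms hS hπ 0 (by simpa using hex)
    simp only [sub_zero] at hle
    exact ⟨a, hum, fun x => ⟨ha x, fun a' ha' =>
        (DRSystem.finiteValue_le_treeSup hS hπ x ha').trans (hle x)⟩,
      DRSystem.isOptimalAdversary_stationary hS hπ ha
        (DRSystem.measurable_atomic.comp_universallyMeasurable hum) hle⟩
  · have hle : ∀ x, DRSystem.treeSup π x ≤ S.finiteValue π (DRSystem.treeSup π) x (a x) :=
      fun x => (hex x).elim fun a' h => h.2.trans ((ha x).2 h.1)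
    refine ⟨fun x => ⟨S.atomic_mem_ball (ha x).1, fun μ hμ => ?_⟩, fun hum =>
      DRSystem.isOptimalAdversary_stationary hS hπ (fun x => (ha x).1) hum hle⟩
    obtain ⟨a', ha', h⟩ := DRSystem.exists_stageValue_treeSup_le hS hπ x hμ
    change S.stageValue π _ x μ ≤ S.stageValue π _ x (S.atomic (a x))
    rw [S.stageValue_atomic]
    exact h.trans ((ha x).2 ha')
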